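/- **Setting.** Let $n\ge 2$. Indices $a,b,c$ run from $1$ to $n$, repeated indices are summed, subscripts denote derivatives, $^*$ is complex conjugation, and $\partial_\psi,\partial_{\psi^*}$ are the Wirtinger derivatives. Everything is local and smooth ($C^\infty$). Let $\mathscr N$ be the class of equations $$i\psi_t+G\,\psi_{aa}+F=0$$ for a complex function $\psi$ of real variables $(t,x)=(t,x_1,\dots,x_n)$, where $G,F$ are smooth complex-valued functions of $(t,x,\psi,\psi^*,\nabla\psi,\nabla\psi^*)$ on a nonempty open domain and $G$ vanishes nowhere. Let $\mathscr N_0$ (resp. $\bar{\mathscr N}_0$) be the subclass of equations with $G^*\neq-G$ (resp. $G^*=-G$) at every point of the domain. A *point transformation* is a diffeomorphism $\varphi\colon\ \tilde t=T,\ \tilde x_a=X^a,\ \tilde\psi=\Psi$ between open subsets of the space of $(t,x,\psi)$, where $T,X^a$ (real) and $\Psi$ (complex) are functions of $(t,x,\psi,\psi^*)$. It maps one equation to another if its second prolongation maps the set of $2$-jets satisfying the first equation to the set of those satisfying the second. An *admissible transformation* of a class is a triple (equation of the class, point transformation between the domains in $(t,x,\psi)$ mapping the first equation to the second, equation of the class).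 The *equivalence group* $G^\sim$ of a class consists of the point transformations $\Phi$ in the space of $(t,x,\psi,\psi^*,\nabla\psi,\nabla\psi^*,G,G^*,F,F^*)$ with $G\ne0$ (local in $(t,x,\psi)$, defined for all values of $\nabla\psi$, $G\neq0$, $F$) that project to a point transformation $\varphi$ of $(t,x,\psi)$, act on $\nabla\psi$ by the prolongation of $\varphi$, and send the arbitrary elements $(G,F)$ of each equation of the class whose domain lies over that of $\varphi$ to those of an equation of the class to which $\varphi$ maps the initial equation. A class is *normalized* if each of its admissible transformations is induced by an element of its equivalence group. Consider the following conditions, in which $H$ is a positive smooth real-valued function with $H_\psi=H_{\psi^*}=0$ (i.e. locally a function of $(t,x)$): (A) $T_\psi=T_{\psi^*}=0,\quad T_a=0,\quad T_t\ne0,\quad X^a_\psi=X^a_{\psi^*}=0,\quad X^b_aX^c_a=H\delta_{bc}$; (B) $\tilde G=\dfrac{H}{T_t}G$ where $\Psi_\psi\ne0$, and $\tilde G=-\dfrac{H}{T_t}G^*$ where $\Psi_{\psi^*}\neq0$; (C) $\displaystyle \tilde F=\frac{\Psi_\psi}{T_t}F-\frac{\Psi_{\psi^*}}{T_t}F^*-\Big(\hat\Delta\Psi+\frac{n-2}{2}\frac{H_a}{H}\mathrm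 D_a\Psi\Big)\frac{\tilde G}{H}-\frac{i}{T_t}\Big(\Psi_t-X^b_t\frac{X^b_a}{H}\mathrm D_a\Psi\Big)$, where $\mathrm D_a\Psi=\Psi_a+\psi_a\Psi_\psi+\psi^*_a\Psi_{\psi^*}$ and $\hat\Delta=\partial_{aa}+2\psi_a\partial_{a\psi}+2\psi^*_a\partial_{a\psi^*}+\psi_a\psi_a\partial_{\psi\psi}+2\psi_a\psi^*_a\partial_{\psi\psi^*}+\psi^*_a\psi^*_a\partial_{\psi^*\psi^*}$. **Statement.** 1. The class $\mathscr N$ is not normalized. Its equivalence group $G^\sim_{\mathscr N}$ consists of the transformations $\Phi$ whose components satisfy (A), $\Psi_\psi\Psi_{\psi^*}=0$, (B) and (C) for some $H$; every point transformation $\varphi$ satisfying (A) for some $H$ and $\Psi_\psi\Psi_{\psi^*}=0$ is the projection of an element of $G^\sim_{\mathscr N}$. 2. $\mathscr N_0$ and $\bar{\mathscr N}_0$ are disjoint subclasses of $\mathscr N$ that partition $\mathscr N$ locally: the domain of each equation of $\mathscr N$ contains disjoint open subsets $U_0$ and $U_1$ with dense union such that the equation restricted to $U_0$ (if nonempty)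 belongs to $\mathscr N_0$ and restricted to $U_1$ (if nonempty) belongs to $\bar{\mathscr N}_0$. 3. The classes $\mathscr N_0$ and $\bar{\mathscr N}_0$ are normalized, and no point transformation maps an equation of one of them to an equation of the other one. 4. $G^\sim_{\mathscr N_0}=G^\sim_{\mathscr N}$. 5. The equivalence group $G^\sim_{\bar{\mathscr N}_0}$ consists of the transformations $\Phi$ whose components satisfy (A) for some $H$ and, at the points with $G^*=-G$, also (B) and (C); every point transformation $\varphi$ satisfying (A) for some $H$ is the projection of an element of $G^\sim_{\bar{\mathscr N}_0}$. -/

import Mathlib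

open Set Filter Topology ComplexConjugate
open scoped ContDiff

noncomputable section

namespace GenSchr

/-- The space of independent variables `(t, x)`. -/
abbrev IndepVar (n : ℕ) : Type := ℝ × (Fin n → ℝ)

/-- The space with coordinates `((t, x), ψ)`; the coordinate `ψ*` is the conjugate of `ψ`. -/
abbrev VarSpace (n : ℕ) : Type := IndepVar n × ℂ

/-- The space with coordinates `(((t, x), ψ), ∇ψ)`, on which `G` and `F` are defined. -/
abbrev JetSpace (n : ℕ) : Type := VarSpace n × (Fin n → ℂ)

/-- The space with coordinates `((((t, x), ψ), ∇ψ), (G, F))`. -/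
abbrev TotalSpace (n : ℕ) : Type := JetSpace n × (ℂ × ℂ)

variable {n : ℕ}

/-! ### Derivatives of functions of `(t, x)` -/

/-- `f_t` for a function `f` of `(t, x)`. -/
def timeDeriv (f : IndepVar n → ℂ) (q : IndepVar n) : ℂ := fderiv ℝ f q (1, 0)

/-- `f_a` for a function `f` of `(t, x)`. -/
def spaceDeriv (a : Fin n) (f : IndepVar n → ℂ) (q : IndepVar n) : ℂ :=
  fderiv ℝ f q (0, Pi.single a 1)

/-- The point `(t, x, ψ, ∇ψ)` of the jet space given by `ψ = f` at `q = (t, x)`. -/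
def jet (f : IndepVar n → ℂ) (q : IndepVar n) : JetSpace n :=
  ((q, f q), fun a => spaceDeriv a f q)

/-! ### Equations -/

/-- The data of an equation `i ψ_t + G ψ_aa + F = 0`: the functions `G`, `F` of
`(t, x, ψ, ψ*, ∇ψ, ∇ψ*)` and their domain. Values outside the domain are irrelevant. -/
structure Eqn (n : ℕ) where
  dom : Set (JetSpace n)
  G : JetSpace n → ℂ
  F : JetSpace n → ℂ

namespace Eqn

/-- The projection of the domain to the space of `(t, x, ψ)`. -/
def base (θ : Eqn n) : Set (VarSpace n) := Prod.fst '' θ.dom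

/-- The graph of the arbitrary elements `(G, F)` over the domain. -/
def graph (θ : Eqn n) : Set (TotalSpace n) := (fun j => (j, (θ.G j, θ.F j))) '' θ.dom

/-- The same equation considered on another (smaller) domain. -/
def restrict (θ : Eqn n) (U : Set (JetSpace n)) : Eqn n := ⟨U, θ.G, θ.F⟩

/-- The 2-jet of `f` at `q` belongs to the equation. -/
def SolvedAt (θ : Eqn n) (f : IndepVar n → ℂ) (q : IndepVar n) : Prop :=
  jet f q ∈ θ.dom ∧
    Complex.I * timeDeriv f q + θ.G (jet f q) * ∑ a, spaceDeriv a (spaceDeriv a f) q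
      + θ.F (jet f q) = 0

end Eqn

/-- The class `𝒩`. -/
def classN (n : ℕ) : Set (Eqn n) :=
  {θ | IsOpen θ.dom ∧ θ.dom.Nonempty ∧ ContDiffOn ℝ ∞ θ.G θ.dom ∧ ContDiffOn ℝ ∞ θ.F θ.dom ∧
    ∀ j ∈ θ.dom, θ.G j ≠ 0}

/-- The subclass `𝒩₀` of `𝒩` singled out by `G* ≠ -G`. -/
def classN0 (n : ℕ) : Set (Eqn n) := {θ ∈ classN n | ∀ j ∈ θ.dom, conj (θ.G j) ≠ -θ.G j}

/-- The subclass `𝒩̄₀` of `𝒩` singled out by `G* = -G`. -/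
def classN0bar (n : ℕ) : Set (Eqn n) := {θ ∈ classN n | ∀ j ∈ θ.dom, conj (θ.G j) = -θ.G j}

/-! ### Point transformations and admissible transformations -/

/-- A (local) point transformation in the space of `(t, x, ψ, ψ*)`: a smooth diffeomorphism
between open subsets. -/
structure PointTransf (n : ℕ) where
  map : OpenPartialHomeomorph (VarSpace n) (VarSpace n)
  smooth : ContDiffOn ℝ ∞ map map.source
  smooth_symm : ContDiffOn ℝ ∞ map.symm map.target

namespace PointTransf

/-- `φ` maps the germ at `q` of the graph of `f` into the graph of `f'`, with `q` going to `q'`.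
If `f` and `f'` are smooth, then the jets of `f'` at `q'` are the images of those of `f` at `q`
under the prolongations of `φ`. -/
def MapsGerm (φ : PointTransf n) (f : IndepVar n → ℂ) (q : IndepVar n)
    (f' : IndepVar n → ℂ) (q' : IndepVar n) : Prop :=
  ContDiffAt ℝ ∞ f q ∧ ContDiffAt ℝ ∞ f' q' ∧ (q, f q) ∈ φ.map.source ∧
    φ.map (q, f q) = (q', f' q') ∧
    ∀ᶠ r in 𝓝 q, (φ.map (r, f r)).2 = f' (φ.map (r, f r)).1

/-- `φ` is defined over the domain of `θ` and maps the equation `θ` to the equation `θ'`: the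
second prolongation of `φ` maps the set of 2-jets satisfying `θ` to that of `θ'`. -/
def MapsEqn (φ : PointTransf n) (θ θ' : Eqn n) : Prop :=
  θ.base ⊆ φ.map.source ∧ φ.map '' θ.base = θ'.base ∧
    ∀ f q f' q', φ.MapsGerm f q f' q' → (q, f q) ∈ θ.base →
      (θ.SolvedAt f q ↔ θ'.SolvedAt f' q')

/-- `(θ, φ, θ')` is an admissible transformation: `φ` is a point transformation between the domains
of the equations `θ` and `θ'` mapping `θ` to `θ'`. -/
def IsAdmissible (φ : PointTransf n) (θ θ' : Eqn n) : Prop :=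
  φ.map.source = θ.base ∧ φ.MapsEqn θ θ'

end PointTransf

/-! ### Equivalence groups and normalization -/

/-- A point transformation in the space of `(t, x, ψ, ψ*, ∇ψ, ∇ψ*, G, G*, F, F*)` with `G ≠ 0`
that is projectable to the space of `(t, x, ψ, ψ*)` and to the space of
`(t, x, ψ, ψ*, ∇ψ, ∇ψ*)`, the second projection being the prolongation of the first one.
It is local in `(t, x, ψ)`, and defined for all values of `∇ψ`, `G ≠ 0` and `F`. -/
structure TotalTransf (n : ℕ) where
  base : PointTransf n
  map : OpenPartialHomeomorph (TotalSpace n) (TotalSpace n)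
  smooth : ContDiffOn ℝ ∞ map map.source
  smooth_symm : ContDiffOn ℝ ∞ map.symm map.target
  source_eq : map.source = {e | e.1.1 ∈ base.map.source ∧ e.2.1 ≠ 0}
  target_eq : map.target = {e | e.1.1 ∈ base.map.target ∧ e.2.1 ≠ 0}
  proj_base : ∀ e ∈ map.source, (map e).1.1 = base.map e.1.1
  proj_jet : ∀ e ∈ map.source, ∀ e' ∈ map.source, e.1 = e'.1 → (map e).1 = (map e').1
  prolong : ∀ f q f' q', base.MapsGerm f q f' q' →
    ∀ G F : ℂ, G ≠ 0 → (map (jet f q, (G, F))).1 = jet f' q'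

/-- `Φ` maps the arbitrary elements of `θ` to those of `θ'`. -/
def TotalTransf.MapsArb (Φ : TotalTransf n) (θ θ' : Eqn n) : Prop :=
  Φ.map '' θ.graph = θ'.graph

/-- The equivalence group of a class `C`: the transformations mapping each equation from the class
(with domain over the domain of the transformation) to an equation from the class. -/
def equivGroup (C : Set (Eqn n)) : Set (TotalTransf n) :=
  {Φ | ∀ θ ∈ C, θ.base ⊆ Φ.base.map.source →
    ∃ θ' ∈ C, Φ.MapsArb θ θ' ∧ Φ.base.MapsEqn θ θ'}

/-- A class is normalized if each of its admissible transformations is induced by an element of its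
equivalence group. -/
def IsNormalized (C : Set (Eqn n)) : Prop :=
  ∀ θ ∈ C, ∀ θ' ∈ C, ∀ φ : PointTransf n, φ.IsAdmissible θ θ' →
    ∃ Φ ∈ equivGroup C, Φ.base = φ ∧ Φ.MapsArb θ θ'

/-! ### Derivatives of functions of `(t, x, ψ, ψ*)` -/

/-- `∂_t` -/
def dt (f : VarSpace n → ℂ) (z : VarSpace n) : ℂ := fderiv ℝ f z ((1, 0), 0)

/-- `∂_a` -/
def dx (a : Fin n) (f : VarSpace n → ℂ) (z : VarSpace n) : ℂ :=
  fderiv ℝ f z ((0, Pi.single a 1), 0)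

/-- `∂_ψ` -/
def dpsi (f : VarSpace n → ℂ) (z : VarSpace n) : ℂ :=
  (fderiv ℝ f z (0, 1) - Complex.I * fderiv ℝ f z (0, Complex.I)) / 2

/-- `∂_{ψ*}` -/
def dpsiConj (f : VarSpace n → ℂ) (z : VarSpace n) : ℂ :=
  (fderiv ℝ f z (0, 1) + Complex.I * fderiv ℝ f z (0, Complex.I)) / 2

/-- The total derivative `D_a f = f_a + ψ_a f_ψ + ψ*_a f_{ψ*}`. -/
def totalDx (a : Fin n) (f : VarSpace n → ℂ) (j : JetSpace n) : ℂ :=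
  dx a f j.1 + j.2 a * dpsi f j.1 + conj (j.2 a) * dpsiConj f j.1

/-- The operator `Δ̂ = ∂_aa + 2 ψ_a ∂_{aψ} + 2 ψ*_a ∂_{aψ*} + ψ_a ψ_a ∂_{ψψ}
+ 2 ψ_a ψ*_a ∂_{ψψ*} + ψ*_a ψ*_a ∂_{ψ*ψ*}`. -/
def hatLaplacian (f : VarSpace n → ℂ) (j : JetSpace n) : ℂ :=
  ∑ a, (dx a (dx a f) j.1 + 2 * j.2 a * dx a (dpsi f) j.1
    + 2 * conj (j.2 a) * dx a (dpsiConj f) j.1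
    + j.2 a ^ 2 * dpsi (dpsi f) j.1
    + 2 * j.2 a * conj (j.2 a) * dpsi (dpsiConj f) j.1
    + conj (j.2 a) ^ 2 * dpsiConj (dpsiConj f) j.1)

namespace PointTransf

/-- The `t`-component. -/
def T (φ : PointTransf n) (z : VarSpace n) : ℂ := ((φ.map z).1.1 : ℝ)

/-- The `x_a`-component. -/
def X (φ : PointTransf n) (a : Fin n) (z : VarSpace n) : ℂ := ((φ.map z).1.2 a : ℝ)

/-- The `ψ`-component. -/
def Psi (φ : PointTransf n) (z : VarSpace n) : ℂ := (φ.map z).2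

/-- The equations `T_ψ = T_{ψ*} = 0`, `T_a = 0`, `X^a_ψ = X^a_{ψ*} = 0`, `X^b_a X^c_a = H δ_bc`
with `T_t ≠ 0` and a positive smooth real-valued `H` with `H_ψ = H_{ψ*} = 0`. -/
def ConformalEqs (φ : PointTransf n) (H : VarSpace n → ℝ) : Prop :=
  ContDiffOn ℝ ∞ H φ.map.source ∧
  ∀ z ∈ φ.map.source,
    0 < H z ∧ dpsi (fun w => (H w : ℂ)) z = 0 ∧ dpsiConj (fun w => (H w : ℂ)) z = 0 ∧
    dpsi φ.T z = 0 ∧ dpsiConj φ.T z = 0 ∧ (∀ a, dx a φ.T z = 0) ∧ dt φ.T z ≠ 0 ∧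
    (∀ a, dpsi (φ.X a) z = 0 ∧ dpsiConj (φ.X a) z = 0) ∧
    ∀ b c, ∑ a, dx a (φ.X b) z * dx a (φ.X c) z = if b = c then (H z : ℂ) else 0

/-- The equation `Ψ_ψ Ψ_{ψ*} = 0`. -/
def IsUnmixed (φ : PointTransf n) : Prop :=
  ∀ z ∈ φ.map.source, dpsi φ.Psi z * dpsiConj φ.Psi z = 0

end PointTransf

/-- At the point `e`, the `G`-component of `Φ` is `(H / T_t) G` if `Ψ_ψ ≠ 0` and
`(H / T_t) (-G*)` if `Ψ_{ψ*} ≠ 0`. -/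
def TotalTransf.GFormAt (Φ : TotalTransf n) (H : VarSpace n → ℝ) (e : TotalSpace n) : Prop :=
  (dpsi Φ.base.Psi e.1.1 ≠ 0 → (Φ.map e).2.1 = H e.1.1 / dt Φ.base.T e.1.1 * e.2.1) ∧
  (dpsiConj Φ.base.Psi e.1.1 ≠ 0 → (Φ.map e).2.1 = H e.1.1 / dt Φ.base.T e.1.1 * (-conj e.2.1))

/-- At the point `e`, the `F`-component of `Φ` is
`(Ψ_ψ / T_t) F - (Ψ_{ψ*} / T_t) F* - (Δ̂Ψ + (n - 2)/2 (H_a / H) D_aΨ) G̃ / H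
  - (i / T_t) (Ψ_t - X^b_t (X^b_a / H) D_aΨ)`, where `G̃` is the `G`-component. -/
def TotalTransf.FFormAt (Φ : TotalTransf n) (H : VarSpace n → ℝ) (e : TotalSpace n) : Prop :=
  (Φ.map e).2.2 =
    dpsi Φ.base.Psi e.1.1 / dt Φ.base.T e.1.1 * e.2.2
      - dpsiConj Φ.base.Psi e.1.1 / dt Φ.base.T e.1.1 * conj e.2.2
      - (hatLaplacian Φ.base.Psi e.1
          + ((n : ℂ) - 2) / 2 *
            ∑ a, dx a (fun w => (H w : ℂ)) e.1.1 / H e.1.1 * totalDx a Φ.base.Psi e.1)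
        * ((Φ.map e).2.1 / H e.1.1)
      - Complex.I / dt Φ.base.T e.1.1 *
        (dt Φ.base.Psi e.1.1
          - ∑ b, ∑ a, dt (Φ.base.X b) e.1.1 * (dx a (Φ.base.X b) e.1.1 / H e.1.1)
              * totalDx a Φ.base.Psi e.1)

end GenSchr

end

/-!
Over each `1`-jet the `2`-jets satisfying an equation of `𝒩` have free second `x`-derivatives: only
`ψ_t` is prescribed. How a point transformation acts on these free second derivatives forces
`T = T(t)`, `X = X(t, x)` and, since `n ≥ 2`, conformality of `X`. The remaining second-order terms
then express `G̃` through `G` where `Ψ_ψ ≠ 0` and through `G*` where `Ψ_ψ* ≠ 0`, and where both are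
nonzero the two expressions agree only if `G* = -G`. Hence mixed transformations such as
`ψ̃ = 2ψ + ψ*` are admissible in `𝒩̄₀` but not in `𝒩₀`. Conversely, each transformation satisfying
(A) acts affinely and invertibly on `∇ψ` and on `(G, F)`, so it extends to an equivalence
transformation; equations with constant `G` and `F` show that there are no other ones.
-/

noncomputable section

namespace GenSchr

variable {n : ℕ}

/-! ### First and second derivatives -/

section Calculus
variable {E F G : Type*} [NormedAddCommGroup E] [NormedSpace ℝ E] [NormedAddCommGroup F]
  [NormedSpace ℝ F] [NormedAddCommGroup G] [NormedSpace ℝ G]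

lemma contDiffAt_two_of_infty {f : E → F} {x : E} (hf : ContDiffAt ℝ ∞ f x) :
    ContDiffAt ℝ 2 f x :=
  contDiffAt_infty.1 hf 2

lemma eventually_differentiableAt {f : E → F} {x : E} (hf : ContDiffAt ℝ 2 f x) :
    ∀ᶠ y in 𝓝 x, DifferentiableAt ℝ f y := by
  filter_upwards [hf.eventually (by simp)] with y hy using hy.differentiableAt (by simp)

lemma differentiableAt_fderiv {f : E → F} {x : E} (hf : ContDiffAt ℝ 2 f x) :
    DifferentiableAt ℝ (fderiv ℝ f) x :=
  (hf.fderiv_right (m := 1) (by norm_num)).differentiableAt (by simp)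

lemma fderiv_fderiv_comp {g : F → G} {h : E → F} {x : E} (hg : ContDiffAt ℝ 2 g (h x))
    (hh : ContDiffAt ℝ 2 h x) (u v : E) :
    fderiv ℝ (fderiv ℝ (g ∘ h)) x u v =
      fderiv ℝ (fderiv ℝ g) (h x) (fderiv ℝ h x u) (fderiv ℝ h x v)
        + fderiv ℝ g (h x) (fderiv ℝ (fderiv ℝ h) x u v) := by
  have chain_rule :
      fderiv ℝ (g ∘ h) =ᶠ[𝓝 x] fun y => (fderiv ℝ g (h y)).comp (fderiv ℝ h y) := by
    filter_upwards [eventually_differentiableAt hh,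
      hh.continuousAt.eventually (eventually_differentiableAt hg)] with y hhy hgy
    exact fderiv_comp y hgy hhy
  have outer : HasFDerivAt (fun y => fderiv ℝ g (h y))
      ((fderiv ℝ (fderiv ℝ g) (h x)).comp (fderiv ℝ h x)) x :=
    (differentiableAt_fderiv hg).hasFDerivAt.comp x (hh.differentiableAt (by simp)).hasFDerivAt
  rw [chain_rule.fderiv_eq,
    (outer.clm_comp (differentiableAt_fderiv hh).hasFDerivAt).fderiv]
  simp [add_comm]

lemma fderiv_clm_comp_apply (A : F →L[ℝ] G) {h : E → F} {x : E} (hh : DifferentiableAt ℝ h x)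
    (u : E) : fderiv ℝ (fun y => A (h y)) x u = A (fderiv ℝ h x u) :=
  DFunLike.congr_fun (A.hasFDerivAt.comp x hh.hasFDerivAt).fderiv u

lemma fderiv_fderiv_clm_comp (A : F →L[ℝ] G) {h : E → F} {x : E} (hh : ContDiffAt ℝ 2 h x)
    (u v : E) : fderiv ℝ (fderiv ℝ (fun y => A (h y))) x u v = A (fderiv ℝ (fderiv ℝ h) x u v) := by
  have hA : fderiv ℝ A = fun _ => A := funext fun _ => A.fderiv
  have h := fderiv_fderiv_comp A.contDiff.contDiffAt hh u v
  rw [hA] at h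
  simpa [Function.comp_def] using h

lemma fderiv_fderiv_apply {f : E → F} {x : E} (hf : ContDiffAt ℝ 2 f x) (u v : E) :
    fderiv ℝ (fun y => fderiv ℝ f y v) x u = fderiv ℝ (fderiv ℝ f) x u v := by
  rw [((differentiableAt_fderiv hf).hasFDerivAt.clm_apply (hasFDerivAt_const v x)).fderiv]
  simp

lemma fderiv_fderiv_symm {f : E → F} {x : E} (hf : ContDiffAt ℝ 2 f x) (u v : E) :
    fderiv ℝ (fderiv ℝ f) x u v = fderiv ℝ (fderiv ℝ f) x v u :=
  (hf.isSymmSndFDerivAt (by simp)) u v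

/-- The quadratic polynomial `c + l (r - q) + B (r - q, r - q) / 2` in `r`: a smooth function with
a prescribed `2`-jet at `q`. -/
def quadratic (c : F) (l : E →L[ℝ] F) (B : E →L[ℝ] E →L[ℝ] F) (q r : E) : F :=
  c + l (r - q) + (1 / 2 : ℝ) • B (r - q) (r - q)

variable (c : F) (l : E →L[ℝ] F) (B : E →L[ℝ] E →L[ℝ] F) (q : E)

lemma quadratic_self : quadratic c l B q q = c := by simp [quadratic]

lemma contDiff_quadratic {m : WithTop ℕ∞} : ContDiff ℝ m (quadratic c l B q) := by
  unfold quadratic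
  fun_prop

lemma fderiv_quadratic (hB : ∀ u v, B u v = B v u) :
    fderiv ℝ (quadratic c l B q) = fun r => l + B (r - q) := by
  funext r
  have hr : HasFDerivAt (fun r : E => r - q) (ContinuousLinearMap.id ℝ E) r :=
    (hasFDerivAt_id r).sub_const q
  have hquad := (B.hasFDerivAt.comp r hr).clm_apply hr
  have hall : fderiv ℝ (quadratic c l B q) r = _ :=
    (((l.hasFDerivAt.comp r hr).const_add c).add (hquad.const_smul (1 / 2 : ℝ))).fderiv
  rw [hall]
  ext v
  simp only [add_apply, smul_apply, ContinuousLinearMap.comp_apply,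
    ContinuousLinearMap.flip_apply, ContinuousLinearMap.id_apply, Function.comp_apply, hB v]
  rw [← two_smul ℝ (B (r - q) v), smul_smul]
  norm_num

lemma fderiv_quadratic_self (hB : ∀ u v, B u v = B v u) :
    fderiv ℝ (quadratic c l B q) q = l := by
  rw [fderiv_quadratic c l B q hB]; simp

lemma fderiv_fderiv_quadratic (hB : ∀ u v, B u v = B v u) :
    fderiv ℝ (fderiv ℝ (quadratic c l B q)) q = B := by
  rw [fderiv_quadratic c l B q hB]
  have hq : HasFDerivAt (fun r : E => r - q) (ContinuousLinearMap.id ℝ E) q :=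
    (hasFDerivAt_id q).sub_const q
  exact ((B.hasFDerivAt.comp q hq).const_add l).fderiv.trans (B.comp_id)

end Calculus

/-! ### Generic graphs -/

section GenericGraph

lemma exists_forall_injective_add_smul_comp {K E V : Type*} [Field K] [AddCommGroup E] [Module K E]
    [FiniteDimensional K E] [AddCommGroup V] [Module K V] (A : E →ₗ[K] E) (C : V →ₗ[K] E)
    (hAC : Codisjoint (LinearMap.range A) (LinearMap.range C)) :
    ∃ l : E →ₗ[K] V, ∀ ε : K, ε ≠ 0 → Function.Injective (A + ε • (C ∘ₗ l)) := by
  obtain ⟨Q, hQC, hQ⟩ := hAC.symm.exists_isCompl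
  have hdim : Module.finrank K (LinearMap.ker A) = Module.finrank K Q := by
    have rank_nullity := LinearMap.finrank_range_add_finrank_ker A
    have complement := Submodule.finrank_add_eq_of_isCompl hQ
    omega
  let e : LinearMap.ker A ≃ₗ[K] Q := LinearEquiv.ofFinrankEq _ _ hdim
  obtain ⟨π, hπ⟩ := (LinearMap.ker A).subtype.exists_leftInverse_of_injective (by simp)
  obtain ⟨s, hs⟩ := C.rangeRestrict.exists_rightInverse_of_surjective (by simp)
  have hCs (y) : C (s y) = y := congrArg Subtype.val (LinearMap.congr_fun hs y)
  refine ⟨s ∘ₗ Submodule.inclusion hQC ∘ₗ e.toLinearMap ∘ₗ π, fun ε hε => ?_⟩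
  rw [injective_iff_map_eq_zero]
  intro v hv
  replace hv : A v + ε • (e (π v) : E) = 0 := by simpa [hCs] using hv
  have hAv : A v = 0 := by
    refine Submodule.disjoint_def.1 hQ.symm.disjoint _ ⟨v, rfl⟩ ?_
    rw [eq_neg_of_add_eq_zero_left hv]
    exact Q.neg_mem (Q.smul_mem _ (e (π v)).2)
  rw [hAv, zero_add, smul_eq_zero, or_iff_right hε] at hv
  have hπv : π v = ⟨v, hAv⟩ := LinearMap.congr_fun hπ ⟨v, hAv⟩
  simpa [hπv, Subtype.ext_iff] using hv

variable {E V : Type*} [NormedAddCommGroup E] [NormedSpace ℝ E] [FiniteDimensional ℝ E]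
  [NormedAddCommGroup V] [NormedSpace ℝ V]

lemma dense_setOf_injective_on_graph {M : E × V →L[ℝ] E} (hM : Function.Surjective M) :
    Dense {l : E →L[ℝ] V | Function.Injective fun v => M (v, l v)} := by
  intro l₀
  let A : E →ₗ[ℝ] E := (M.comp ((ContinuousLinearMap.id ℝ E).prod l₀)).toLinearMap
  let C : V →ₗ[ℝ] E := (M.comp (ContinuousLinearMap.inr ℝ E V)).toLinearMap
  have hAC : Codisjoint (LinearMap.range A) (LinearMap.range C) := by
    rw [codisjoint_iff, eq_top_iff]
    intro y _
    obtain ⟨⟨v, w⟩, rfl⟩ := hM y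
    refine Submodule.mem_sup.2 ⟨_, ⟨v, rfl⟩, _, ⟨w - l₀ v, rfl⟩, ?_⟩
    change M (v, l₀ v) + M (0, w - l₀ v) = M (v, w)
    rw [← map_add]
    simp
  obtain ⟨l₁, hl₁⟩ := exists_forall_injective_add_smul_comp A C hAC
  have hlim : Tendsto (fun ε : ℝ => l₀ + ε • l₁.toContinuousLinearMap) (𝓝[≠] 0) (𝓝 l₀) :=
    ((by fun_prop : Continuous fun ε : ℝ => l₀ + ε • l₁.toContinuousLinearMap).tendsto'
      0 l₀ (by simp)).mono_left nhdsWithin_le_nhds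
  refine mem_closure_of_tendsto hlim ?_
  filter_upwards [self_mem_nhdsWithin] with ε hε
  convert hl₁ ε hε using 1
  funext v
  change M (v, l₀ v + ε • l₁ v) = M (v, l₀ v) + ε • M (0, l₁ v)
  rw [← map_smul M, ← map_add]
  simp

end GenericGraph

/-! ### Coordinate directions -/

/-- The direction of the coordinate `t`. -/
def timeVec : IndepVar n := (1, 0)

/-- The direction of the coordinate `x_a`. -/
def spaceVec (a : Fin n) : IndepVar n := (0, Pi.single a 1)

/-- The coordinate `x_a` as a linear functional. -/
def spaceCoord (a : Fin n) : IndepVar n →L[ℝ] ℝ :=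
  (ContinuousLinearMap.proj a).comp (ContinuousLinearMap.snd ℝ ℝ (Fin n → ℝ))

lemma spaceCoord_apply (a : Fin n) (v : IndepVar n) : spaceCoord a v = v.2 a := rfl

lemma eq_smul_timeVec_add_sum_smul_spaceVec (v : IndepVar n) :
    v = v.1 • timeVec + ∑ a, v.2 a • spaceVec a := by
  ext a
  · simp [timeVec, spaceVec, Prod.fst_sum]
  · simp [timeVec, spaceVec, Prod.snd_sum, Finset.sum_apply, Pi.single_apply]

lemma exists_linear_apply_timeVec_apply_spaceVec (τ : ℂ) (p : Fin n → ℂ) :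
    ∃ l : IndepVar n →L[ℝ] ℂ, l timeVec = τ ∧ ∀ a, l (spaceVec a) = p a := by
  refine ⟨(ContinuousLinearMap.fst ℝ ℝ (Fin n → ℝ)).smulRight τ
    + ∑ a, (spaceCoord a).smulRight (p a), ?_, fun a => ?_⟩
  · simp [timeVec, spaceCoord_apply, sum_apply]
  · simp [spaceVec, spaceCoord_apply, sum_apply, Pi.single_apply]

lemma exists_symm_bilinear_trace_eq [NeZero n] (c : ℂ) :
    ∃ B : IndepVar n →L[ℝ] IndepVar n →L[ℝ] ℂ,
      (∀ u v, B u v = B v u) ∧ ∑ a, B (spaceVec a) (spaceVec a) = c := by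
  refine ⟨(spaceCoord 0).smulRight ((spaceCoord 0).smulRight c), fun u v => ?_, ?_⟩
  · simp [mul_left_comm]
  · simp only [ContinuousLinearMap.smulRight_apply, smul_apply, spaceCoord_apply, spaceVec]
    simp [Pi.single_apply]

lemma jet_eq (f : IndepVar n → ℂ) (q : IndepVar n) :
    jet f q = ((q, f q), fun a => fderiv ℝ f q (spaceVec a)) := rfl

lemma spaceDeriv_spaceDeriv {f : IndepVar n → ℂ} {q : IndepVar n} (hf : ContDiffAt ℝ 2 f q)
    (a : Fin n) :
    spaceDeriv a (spaceDeriv a f) q = fderiv ℝ (fderiv ℝ f) q (spaceVec a) (spaceVec a) :=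
  fderiv_fderiv_apply hf _ _

lemma Eqn.solvedAt_iff {θ : Eqn n} {f : IndepVar n → ℂ} {q : IndepVar n}
    (hf : ContDiffAt ℝ 2 f q) :
    θ.SolvedAt f q ↔ jet f q ∈ θ.dom ∧ Complex.I * fderiv ℝ f q timeVec
      + θ.G (jet f q) * ∑ a, fderiv ℝ (fderiv ℝ f) q (spaceVec a) (spaceVec a)
      + θ.F (jet f q) = 0 := by
  simp only [Eqn.SolvedAt, spaceDeriv_spaceDeriv hf]
  rfl

lemma Eqn.solvedAt_congr {θ : Eqn n} {f g : IndepVar n → ℂ} {q : IndepVar n}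
    (hf : ContDiffAt ℝ 2 f q) (hg : ContDiffAt ℝ 2 g q) (heq : f q = g q)
    (hfderiv : fderiv ℝ f q = fderiv ℝ g q)
    (htrace : ∑ a, fderiv ℝ (fderiv ℝ f) q (spaceVec a) (spaceVec a) =
      ∑ a, fderiv ℝ (fderiv ℝ g) q (spaceVec a) (spaceVec a)) :
    θ.SolvedAt f q ↔ θ.SolvedAt g q := by
  rw [Eqn.solvedAt_iff hf, Eqn.solvedAt_iff hg, jet_eq, jet_eq, heq, hfderiv, htrace]

/-! ### Wirtinger derivatives -/

section Wirtinger

lemma fderiv_vertical (f : VarSpace n → ℂ) (z : VarSpace n) (w : ℂ) :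
    fderiv ℝ f z (0, w) = dpsi f z * w + dpsiConj f z * conj w := by
  have h : ((0, w) : VarSpace n) = w.re • (0, 1) + w.im • (0, Complex.I) := by
    ext <;> simp
  rw [h, map_add, map_smul, map_smul, dpsi, dpsiConj]
  conv_rhs => rw [← Complex.re_add_im w]
  simp only [Complex.real_smul, map_add, map_mul, Complex.conj_ofReal, Complex.conj_I]
  linear_combination ((w.im : ℂ) * fderiv ℝ f z (0, Complex.I)) * Complex.I_sq

lemma dpsi_eq_zero_and_dpsiConj_eq_zero_iff {f : VarSpace n → ℂ} {z : VarSpace n} :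
    (dpsi f z = 0 ∧ dpsiConj f z = 0) ↔ ∀ w, fderiv ℝ f z (0, w) = 0 := by
  constructor
  · rintro ⟨hpsi, hpsiConj⟩ w
    simp [fderiv_vertical, hpsi, hpsiConj]
  · intro h
    simp [dpsi, dpsiConj, h]

lemma totalDx_eq (a : Fin n) (f : VarSpace n → ℂ) (j : JetSpace n) :
    totalDx a f j = fderiv ℝ f j.1 (spaceVec a, j.2 a) := by
  have h : ((spaceVec a, j.2 a) : VarSpace n) = (spaceVec a, 0) + (0, j.2 a) := by simp
  rw [h, map_add, fderiv_vertical, totalDx, dx, spaceVec]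
  ring

variable {f : VarSpace n → ℂ} {z : VarSpace n}

lemma fderiv_dx (hf : ContDiffAt ℝ 2 f z) (a : Fin n) (u : VarSpace n) :
    fderiv ℝ (dx a f) z u = fderiv ℝ (fderiv ℝ f) z u (spaceVec a, 0) :=
  fderiv_fderiv_apply hf _ _

lemma hasFDerivAt_fderiv_apply (hf : ContDiffAt ℝ 2 f z) (v : VarSpace n) :
    HasFDerivAt (fun y => fderiv ℝ f y v) ((fderiv ℝ (fderiv ℝ f) z).flip v) z := by
  simpa using (differentiableAt_fderiv hf).hasFDerivAt.clm_apply (hasFDerivAt_const v z)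

lemma fderiv_dpsi (hf : ContDiffAt ℝ 2 f z) (u : VarSpace n) :
    fderiv ℝ (dpsi f) z u =
      (fderiv ℝ (fderiv ℝ f) z u (0, 1) - Complex.I * fderiv ℝ (fderiv ℝ f) z u (0, Complex.I))
        / 2 := by
  have h : fderiv ℝ (dpsi f) z = _ := (((hasFDerivAt_fderiv_apply hf (0, 1)).sub
    ((hasFDerivAt_fderiv_apply hf (0, Complex.I)).const_mul Complex.I)).mul_const (2⁻¹ : ℂ)).fderiv
  simp [h, div_eq_inv_mul]

lemma fderiv_dpsiConj (hf : ContDiffAt ℝ 2 f z) (u : VarSpace n) :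
    fderiv ℝ (dpsiConj f) z u =
      (fderiv ℝ (fderiv ℝ f) z u (0, 1) + Complex.I * fderiv ℝ (fderiv ℝ f) z u (0, Complex.I))
        / 2 := by
  have h : fderiv ℝ (dpsiConj f) z = _ := (((hasFDerivAt_fderiv_apply hf (0, 1)).add
    ((hasFDerivAt_fderiv_apply hf (0, Complex.I)).const_mul Complex.I)).mul_const (2⁻¹ : ℂ)).fderiv
  simp [h, div_eq_inv_mul, mul_add]

lemma hatLaplacian_eq (hf : ContDiffAt ℝ 2 f z) (p : Fin n → ℂ) :
    hatLaplacian f (z, p) =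
      ∑ a, fderiv ℝ (fderiv ℝ f) z (spaceVec a, p a) (spaceVec a, p a) := by
  refine Finset.sum_congr rfl fun a _ => ?_
  have hdx (g : VarSpace n → ℂ) : dx a g z = fderiv ℝ g z (spaceVec a, 0) := rfl
  have hsplit : ((spaceVec a, p a) : VarSpace n) =
      (spaceVec a, 0) + ((p a).re • (0, 1) + (p a).im • (0, Complex.I)) := by
    ext <;> simp
  rw [hsplit]
  simp only [hdx, fderiv_dx hf, fderiv_dpsi hf, fderiv_dpsiConj hf, dpsi, dpsiConj, map_add,
    map_smul, add_apply, smul_apply, Complex.real_smul,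
    fderiv_fderiv_symm hf (spaceVec a, 0) (0, 1),
    fderiv_fderiv_symm hf (spaceVec a, 0) (0, Complex.I),
    fderiv_fderiv_symm hf (0, Complex.I) (0, 1)]
  conv_lhs => rw [← Complex.re_add_im (p a)]
  simp only [map_add, map_mul, Complex.conj_ofReal, Complex.conj_I]
  ring_nf
  simp only [Complex.I_sq, Complex.I_pow_four]
  ring

end Wirtinger

/-! ### Jets of transformed functions -/

namespace PointTransf

section Differential
variable (φ : PointTransf n) {z : VarSpace n}

/-- The differential of the new independent variables `(T, X)` at a point. -/
def indepDiff (z : VarSpace n) : VarSpace n →L[ℝ] IndepVar n :=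
  (ContinuousLinearMap.fst ℝ (IndepVar n) ℂ).comp (fderiv ℝ φ.map z)

lemma indepDiff_apply (z u : VarSpace n) : φ.indepDiff z u = (fderiv ℝ φ.map z u).1 := rfl

lemma contDiffAt (hz : z ∈ φ.map.source) : ContDiffAt ℝ ∞ φ.map z :=
  φ.smooth.contDiffAt (φ.map.open_source.mem_nhds hz)

lemma contDiffAt_two (hz : z ∈ φ.map.source) : ContDiffAt ℝ 2 φ.map z :=
  contDiffAt_two_of_infty (φ.contDiffAt hz)

lemma differentiableAt (hz : z ∈ φ.map.source) : DifferentiableAt ℝ φ.map z :=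
  (φ.contDiffAt hz).differentiableAt (by simp)

lemma fderiv_bijective (hz : z ∈ φ.map.source) : Function.Bijective (fderiv ℝ φ.map z) := by
  have hmdiff : φ.map.MDifferentiable (modelWithCornersSelf ℝ (VarSpace n))
      (modelWithCornersSelf ℝ (VarSpace n)) :=
    ⟨mdifferentiableOn_iff_differentiableOn.2 (φ.smooth.differentiableOn (by simp)),
      mdifferentiableOn_iff_differentiableOn.2 (φ.smooth_symm.differentiableOn (by simp))⟩
  have hbij := hmdiff.mfderiv_bijective hz
  rwa [mfderiv_eq_fderiv] at hbij

lemma indepDiff_surjective (hz : z ∈ φ.map.source) : Function.Surjective (φ.indepDiff z) :=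
  Prod.fst_surjective.comp (φ.fderiv_bijective hz).2

end Differential

variable {φ : PointTransf n} {f f' : IndepVar n → ℂ} {q q' : IndepVar n}

lemma fderiv_graph (hf : DifferentiableAt ℝ f q) (v : IndepVar n) :
    fderiv ℝ (fun r => (r, f r)) q v = (v, fderiv ℝ f q v) := by
  rw [DifferentiableAt.fderiv_prodMk differentiableAt_fun_id hf]
  simp

lemma fderiv_fderiv_graph (hf : ContDiffAt ℝ 2 f q) (u v : IndepVar n) :
    fderiv ℝ (fderiv ℝ (fun r => (r, f r))) q u v = (0, fderiv ℝ (fderiv ℝ f) q u v) := by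
  have hgraph : ContDiffAt ℝ 2 (fun r => (r, f r)) q := contDiffAt_id.prodMk hf
  ext1
  · have h := fderiv_fderiv_clm_comp (ContinuousLinearMap.fst ℝ (IndepVar n) ℂ) hgraph u v
    have hid : fderiv ℝ (fun r : IndepVar n => r) = fun _ => ContinuousLinearMap.id ℝ _ :=
      funext fun _ => fderiv_fun_id
    simpa [hid] using h.symm
  · exact (fderiv_fderiv_clm_comp (ContinuousLinearMap.snd ℝ (IndepVar n) ℂ) hgraph u v).symm

lemma contDiffAt_map_graph (hf : ContDiffAt ℝ ∞ f q) (hq : (q, f q) ∈ φ.map.source) :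
    ContDiffAt ℝ ∞ (fun r => φ.map (r, f r)) q :=
  ContDiffAt.comp q (φ.contDiffAt hq) (contDiffAt_id.prodMk hf)

lemma fderiv_map_graph (hf : DifferentiableAt ℝ f q) (hq : (q, f q) ∈ φ.map.source)
    (v : IndepVar n) : fderiv ℝ (fun r => φ.map (r, f r)) q v =
      fderiv ℝ φ.map (q, f q) (v, fderiv ℝ f q v) := by
  rw [← fderiv_graph hf]
  exact DFunLike.congr_fun (fderiv_comp q (g := φ.map) (f := fun r => (r, f r))
    (φ.differentiableAt hq) (differentiableAt_id.prodMk hf)) v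

lemma fderiv_fderiv_map_graph (hf : ContDiffAt ℝ 2 f q) (hq : (q, f q) ∈ φ.map.source)
    (u v : IndepVar n) : fderiv ℝ (fderiv ℝ (fun r => φ.map (r, f r))) q u v =
      fderiv ℝ (fderiv ℝ φ.map) (q, f q) (u, fderiv ℝ f q u) (v, fderiv ℝ f q v)
        + fderiv ℝ φ.map (q, f q) (0, fderiv ℝ (fderiv ℝ f) q u v) := by
  have hf' := hf.differentiableAt (by simp)
  rw [← fderiv_graph hf', ← fderiv_graph hf', ← fderiv_fderiv_graph hf]
  exact fderiv_fderiv_comp (g := φ.map) (h := fun r => (r, f r)) (φ.contDiffAt_two hq)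
    (contDiffAt_id.prodMk hf) u v

namespace MapsGerm

lemma fderiv_eq (h : φ.MapsGerm f q f' q') (v : IndepVar n) :
    (fderiv ℝ φ.map (q, f q) (v, fderiv ℝ f q v)).2 =
      fderiv ℝ f' q' (φ.indepDiff (q, f q) (v, fderiv ℝ f q v)) := by
  obtain ⟨hf, hf', hq, himage, hgraph⟩ := h
  obtain rfl : (φ.map (q, f q)).1 = q' := by rw [himage]
  have hP := (contDiffAt_map_graph hf hq).differentiableAt (by simp)
  have hfst := fderiv_clm_comp_apply (ContinuousLinearMap.fst ℝ (IndepVar n) ℂ) hP v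
  have hsnd := fderiv_clm_comp_apply (ContinuousLinearMap.snd ℝ (IndepVar n) ℂ) hP v
  simp only [ContinuousLinearMap.coe_fst', ContinuousLinearMap.coe_snd'] at hfst hsnd
  rw [indepDiff_apply, ← fderiv_map_graph (hf.differentiableAt (by simp)) hq, ← hfst, ← hsnd,
    EventuallyEq.fderiv_eq hgraph]
  exact DFunLike.congr_fun (fderiv_comp q (g := f') (f := fun r => (φ.map (r, f r)).1)
    (hf'.differentiableAt (by simp)) hP.fst) v

lemma fderiv_fderiv_eq (h : φ.MapsGerm f q f' q') (u v : IndepVar n) :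
    (fderiv ℝ (fderiv ℝ φ.map) (q, f q) (u, fderiv ℝ f q u) (v, fderiv ℝ f q v)
        + fderiv ℝ φ.map (q, f q) (0, fderiv ℝ (fderiv ℝ f) q u v)).2 =
      fderiv ℝ (fderiv ℝ f') q' (φ.indepDiff (q, f q) (u, fderiv ℝ f q u))
          (φ.indepDiff (q, f q) (v, fderiv ℝ f q v))
        + fderiv ℝ f' q' (fderiv ℝ (fderiv ℝ φ.map) (q, f q) (u, fderiv ℝ f q u)
            (v, fderiv ℝ f q v) + fderiv ℝ φ.map (q, f q) (0, fderiv ℝ (fderiv ℝ f) q u v)).1 := by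
  obtain ⟨hf, hf', hq, himage, hgraph⟩ := h
  obtain rfl : (φ.map (q, f q)).1 = q' := by rw [himage]
  have hf₂ := contDiffAt_two_of_infty hf
  have hP := contDiffAt_two_of_infty (contDiffAt_map_graph hf hq)
  have hPd := hP.differentiableAt (by simp)
  have hfd := hf.differentiableAt (by simp)
  have hfst := fderiv_clm_comp_apply (ContinuousLinearMap.fst ℝ (IndepVar n) ℂ) hPd
  have hfst₂ := fderiv_fderiv_clm_comp (ContinuousLinearMap.fst ℝ (IndepVar n) ℂ) hP u v
  have hsnd₂ := fderiv_fderiv_clm_comp (ContinuousLinearMap.snd ℝ (IndepVar n) ℂ) hP u v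
  simp only [ContinuousLinearMap.coe_fst', ContinuousLinearMap.coe_snd'] at hfst hfst₂ hsnd₂
  rw [indepDiff_apply, indepDiff_apply, ← fderiv_fderiv_map_graph hf₂ hq,
    ← fderiv_map_graph hfd hq, ← fderiv_map_graph hfd hq, ← hfst, ← hfst, ← hfst₂, ← hsnd₂,
    (EventuallyEq.fderiv hgraph).fderiv_eq]
  exact fderiv_fderiv_comp (g := f') (h := fun r => (φ.map (r, f r)).1)
    (contDiffAt_two_of_infty hf') hP.fst u v

end MapsGerm

lemma exists_mapsGerm (hf : ContDiffAt ℝ ∞ f q) (hq : (q, f q) ∈ φ.map.source)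
    (hinj : Function.Injective fun v => φ.indepDiff (q, f q) (v, fderiv ℝ f q v)) :
    ∃ f', φ.MapsGerm f q f' (φ.map (q, f q)).1 := by
  have hP := contDiffAt_map_graph hf hq
  have hPd := hP.differentiableAt (by simp)
  set A := fderiv ℝ (fun r => (φ.map (r, f r)).1) q
  have hAinj : Function.Injective A := by
    convert hinj using 1
    funext v
    rw [indepDiff_apply, ← fderiv_map_graph (hf.differentiableAt (by simp)) hq]
    exact fderiv_clm_comp_apply (ContinuousLinearMap.fst ℝ (IndepVar n) ℂ) hPd v
  let e : IndepVar n ≃L[ℝ] IndepVar n :=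
    (LinearEquiv.ofInjectiveEndo A.toLinearMap hAinj).toContinuousLinearEquiv
  have he : HasFDerivAt (fun r => (φ.map (r, f r)).1) (e : IndepVar n →L[ℝ] IndepVar n) q :=
    hPd.fst.hasFDerivAt.congr_fderiv (ContinuousLinearMap.ext fun _ => rfl)
  let g := hP.fst.localInverse he (by simp)
  have hgq : g (φ.map (q, f q)).1 = q := hP.fst.localInverse_apply_image he (by simp)
  have hg : ContDiffAt ℝ ∞ g (φ.map (q, f q)).1 := hP.fst.to_localInverse he (by simp)
  have hinv : ∀ᶠ r in 𝓝 q, g (φ.map (r, f r)).1 = r :=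
    (hP.fst.hasStrictFDerivAt' he (by simp)).eventually_left_inverse
  refine ⟨fun r' => (φ.map (g r', f (g r'))).2, hf, ?_, hq, ?_, ?_⟩
  · exact ContDiffAt.comp (g := fun r => (φ.map (r, f r)).2) _ (by rw [hgq]; exact hP.snd) hg
  · simp [hgq]
  · filter_upwards [hinv] with r hr
    simp [hr]

lemma exists_mapsGerm_of_jet {z : VarSpace n} (hz : z ∈ φ.map.source)
    {l : IndepVar n →L[ℝ] ℂ} (hinj : Function.Injective fun v => φ.indepDiff z (v, l v))
    {B : IndepVar n →L[ℝ] IndepVar n →L[ℝ] ℂ} (hB : ∀ u v, B u v = B v u) :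
    ∃ f f', φ.MapsGerm f z.1 f' (φ.map z).1 ∧ f z.1 = z.2 ∧ fderiv ℝ f z.1 = l ∧
      fderiv ℝ (fderiv ℝ f) z.1 = B := by
  have hself : quadratic z.2 l B z.1 z.1 = z.2 := quadratic_self ..
  have hl := fderiv_quadratic_self z.2 l B z.1 hB
  obtain ⟨f', hf'⟩ := exists_mapsGerm (φ := φ)
    (contDiff_quadratic z.2 l B z.1).contDiffAt (by rwa [hself]) (by simpa only [hself, hl])
  rw [hself] at hf'
  exact ⟨_, f', hf', hself, hl, fderiv_fderiv_quadratic z.2 l B z.1 hB⟩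

end PointTransf

/-! ### The principal symbol -/

section Symbol

/-- The principal symbol of the operator `∑ a, ∂_{v_a}²` at the covector `α`. -/
def symbol (v : Fin n → IndepVar n) (α : IndepVar n →L[ℝ] ℝ) : ℝ := ∑ a, α (v a) ^ 2

/-- The symbol of `∑ a, ∂_{v_a}²` is a function of that of the Laplacian `∑ a, ∂_a²`. This is what
a transformation of equations imposes on the images `v_a` of the directions `∂_a`. -/
def PreservesSymbol (v : Fin n → IndepVar n) : Prop :=
  ∀ α β, symbol spaceVec α = symbol spaceVec β → symbol v α = symbol v β

variable {v d : Fin n → IndepVar n}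

lemma symbol_add_add_symbol_sub (v d : Fin n → IndepVar n) (α : IndepVar n →L[ℝ] ℝ) :
    symbol (v + d) α + symbol (v - d) α = 2 * symbol v α + 2 * symbol d α := by
  simp only [symbol, Finset.mul_sum, ← Finset.sum_add_distrib]
  refine Finset.sum_congr rfl fun a _ => ?_
  simp only [Pi.add_apply, Pi.sub_apply, map_add, map_sub]
  ring

lemma symbol_smul (s : ℝ) (v : Fin n → IndepVar n) (α : IndepVar n →L[ℝ] ℝ) :
    symbol (s • v) α = s ^ 2 * symbol v α := by
  simp [symbol, Finset.mul_sum, mul_pow]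

lemma symbol_add_sub_symbol_sub (v : Fin n → IndepVar n) (α β : IndepVar n →L[ℝ] ℝ) :
    symbol v (α + β) - symbol v (α - β) = 4 * ∑ a, α (v a) * β (v a) := by
  simp only [symbol, Finset.mul_sum, ← Finset.sum_sub_distrib]
  refine Finset.sum_congr rfl fun a _ => ?_
  simp only [add_apply, sub_apply]
  ring

lemma sum_spaceCoord_mul_spaceCoord (b c : Fin n) :
    ∑ a, spaceCoord b (spaceVec a) * spaceCoord c (spaceVec a) = if b = c then 1 else 0 := by
  simp [spaceCoord_apply, spaceVec, Pi.single_apply]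

lemma symbol_spaceVec_spaceCoord (b : Fin n) : symbol spaceVec (spaceCoord b) = 1 := by
  simpa [symbol, pow_two] using sum_spaceCoord_mul_spaceCoord b b

namespace PreservesSymbol

lemma of_add_of_sub (hv : PreservesSymbol v) (hadd : PreservesSymbol (v + d))
    (hsub : PreservesSymbol (v - d)) : PreservesSymbol d := by
  intro α β h
  have hα := symbol_add_add_symbol_sub v d α
  have hβ := symbol_add_add_symbol_sub v d β
  rw [hadd α β h, hsub α β h, hv α β h] at hα
  linarith

lemma of_smul {s : ℝ} (hs : s ≠ 0) (h : PreservesSymbol (s • d)) : PreservesSymbol d := by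
  intro α β hαβ
  have hsymbol := h α β hαβ
  rw [symbol_smul, symbol_smul] at hsymbol
  exact mul_left_cancel₀ (pow_ne_zero 2 hs) hsymbol

lemma fst_eq_zero (h : PreservesSymbol v) (a : Fin n) : (v a).1 = 0 := by
  have hsum := h (ContinuousLinearMap.fst ℝ ℝ (Fin n → ℝ)) 0 (by simp [symbol, spaceVec])
  simp only [symbol, ContinuousLinearMap.coe_fst', zero_apply, ne_eq, OfNat.ofNat_ne_zero,
    not_false_eq_true, zero_pow, Finset.sum_const_zero] at hsum
  rw [Finset.sum_eq_zero_iff_of_nonneg fun _ _ => sq_nonneg _] at hsum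
  exact pow_eq_zero_iff two_ne_zero |>.1 (hsum a (Finset.mem_univ a))

lemma gram_eq [NeZero n] (h : PreservesSymbol v) (b c : Fin n) :
    ∑ a, (v a).2 b * (v a).2 c = if b = c then ∑ a, (v a).2 0 ^ 2 else 0 := by
  split_ifs with hbc
  · subst hbc
    simpa [symbol, spaceCoord_apply, pow_two] using
      h (spaceCoord b) (spaceCoord 0) (by simp only [symbol_spaceVec_spaceCoord])
  · have hspace := symbol_add_sub_symbol_sub spaceVec (spaceCoord b) (spaceCoord c)
    rw [sum_spaceCoord_mul_spaceCoord, if_neg hbc, mul_zero, sub_eq_zero] at hspace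
    have hv := symbol_add_sub_symbol_sub v (spaceCoord b) (spaceCoord c)
    rw [h _ _ hspace, sub_self] at hv
    simpa [spaceCoord_apply] using hv.symm

lemma eq_zero_of_single (hn : 2 ≤ n) {i : Fin n} {m : IndepVar n}
    (h : PreservesSymbol (Pi.single i m)) : m = 0 := by
  have : NeZero n := ⟨by omega⟩
  have hgram (b c : Fin n) : m.2 b * m.2 c = if b = c then m.2 0 ^ 2 else 0 := by
    simpa [Pi.single_apply, apply_ite Prod.snd, ite_apply, ite_pow] using h.gram_eq b c
  have hne : (⟨0, by omega⟩ : Fin n) ≠ ⟨1, by omega⟩ := by simp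
  have hm : m.2 0 = 0 := by
    have hprod := hgram ⟨0, by omega⟩ ⟨1, by omega⟩
    rw [if_neg hne] at hprod
    rcases mul_eq_zero.1 hprod with hb | hb
    · exact hb
    · simpa [hb] using (hgram ⟨1, by omega⟩ ⟨1, by omega⟩).symm
  refine Prod.ext (by simpa using h.fst_eq_zero i) (funext fun b => ?_)
  simpa [hm] using hgram b b

end PreservesSymbol

variable {M : VarSpace n →L[ℝ] IndepVar n}

lemma isClosed_setOf_preservesSymbol (M : VarSpace n →L[ℝ] IndepVar n) :
    IsClosed {p : Fin n → ℂ | PreservesSymbol fun a => M (spaceVec a, p a)} := by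
  simp only [PreservesSymbol, ofPred_forall, symbol]
  refine isClosed_iInter fun α => isClosed_iInter fun β => isClosed_iInter fun _ => ?_
  exact isClosed_eq (by fun_prop) (by fun_prop)

lemma vertical_eq_zero_of_preservesSymbol (hn : 2 ≤ n) {p : Fin n → ℂ}
    (h : ∀ᶠ p' in 𝓝 p, PreservesSymbol fun a => M (spaceVec a, p' a)) (w : ℂ) :
    M (0, w) = 0 := by
  let i : Fin n := ⟨0, by omega⟩
  let d : Fin n → IndepVar n := Pi.single i (M (0, w))
  have hd (s : ℝ) : (fun a => M (spaceVec a, (p + s • (Pi.single i w : Fin n → ℂ)) a)) =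
      (fun a => M (spaceVec a, p a)) + s • d := by
    funext a
    by_cases ha : a = i
    · subst ha
      simp only [Pi.add_apply, Pi.smul_apply, Pi.single_eq_same, d, ← map_smul, ← map_add]
      simp
    · simp [d, ha]
  have hline (s₀ : ℝ) : Tendsto (fun s : ℝ => p + (s₀ * s) • (Pi.single i w : Fin n → ℂ))
      (𝓝[≠] 0) (𝓝 p) :=
    ((by fun_prop : Continuous fun s : ℝ => p + (s₀ * s) • (Pi.single i w : Fin n → ℂ)).tendsto'
      0 p (by simp)).mono_left nhdsWithin_le_nhds
  obtain ⟨s, ⟨hplus, hminus⟩, hs⟩ := (((hline 1).eventually h).and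
    ((hline (-1)).eventually h)).and self_mem_nhdsWithin |>.exists
  rw [hd] at hplus hminus
  simp only [one_mul, neg_mul, neg_smul, ← sub_eq_add_neg] at hplus hminus
  exact ((h.self_of_nhds.of_add_of_sub hplus hminus).of_smul hs).eq_zero_of_single hn

end Symbol

/-- The differential `M` of new independent variables `(T, X)` satisfies condition (A) with the
value `h` of the conformal factor. -/
structure IsConformal (M : VarSpace n →L[ℝ] IndepVar n) (h : ℝ) : Prop where
  pos : 0 < h
  vertical : ∀ w, M (0, w) = 0
  space_time : ∀ a, (M (spaceVec a, 0)).1 = 0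
  time_time : (M (timeVec, 0)).1 ≠ 0
  orth : ∀ b c, ∑ a, (M (spaceVec a, 0)).2 b * (M (spaceVec a, 0)).2 c = if b = c then h else 0

lemma apply_eq_of_vertical_eq_zero {M : VarSpace n →L[ℝ] IndepVar n} (hM : ∀ w, M (0, w) = 0)
    (v : IndepVar n) (w : ℂ) :
    M (v, w) = v.1 • M (timeVec, 0) + ∑ a, v.2 a • M (spaceVec a, 0) := by
  have h : ((v, w) : VarSpace n) =
      v.1 • (timeVec, 0) + ∑ a, v.2 a • (spaceVec a, (0 : ℂ)) + (0, w) := by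
    refine Prod.ext ?_ (by simp [Prod.snd_sum])
    simpa [Prod.fst_sum] using eq_smul_timeVec_add_sum_smul_spaceVec v
  rw [h, map_add, hM, add_zero, map_add, map_smul, map_sum]
  simp_rw [map_smul M]

lemma exists_isConformal_of_preservesSymbol [NeZero n] {M : VarSpace n →L[ℝ] IndepVar n}
    (hM : Function.Surjective M) (hvertical : ∀ w, M (0, w) = 0)
    (hsymbol : PreservesSymbol fun a => M (spaceVec a, 0)) : ∃ h, IsConformal M h := by
  have hdecomp := apply_eq_of_vertical_eq_zero hvertical
  have hspace_time := hsymbol.fst_eq_zero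
  have htime : (M (timeVec, 0)).1 ≠ 0 := by
    intro hzero
    obtain ⟨⟨v, w⟩, hv⟩ := hM timeVec
    have hfst := congrArg Prod.fst hv
    rw [hdecomp] at hfst
    simp only [Prod.fst_add, Prod.smul_fst, Prod.fst_sum, hspace_time, hzero, smul_zero,
      Finset.sum_const_zero, add_zero] at hfst
    exact zero_ne_one hfst
  refine ⟨∑ a, (M (spaceVec a, 0)).2 0 ^ 2, lt_of_le_of_ne
    (Finset.sum_nonneg fun _ _ => sq_nonneg _) fun hzero => ?_, hvertical, hspace_time, htime,
    hsymbol.gram_eq⟩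
  have hspace (a) : (M (spaceVec a, 0)).2 0 = 0 := by
    rw [eq_comm, Finset.sum_eq_zero_iff_of_nonneg fun _ _ => sq_nonneg _] at hzero
    exact pow_eq_zero_iff two_ne_zero |>.1 (hzero a (Finset.mem_univ a))
  obtain ⟨⟨v, w⟩, hv⟩ := hM (spaceVec 0)
  rw [hdecomp] at hv
  have hv₁ : v.1 = 0 := by
    have hfst : _ = (0 : ℝ) := congrArg Prod.fst hv
    simpa [Prod.fst_sum, hspace_time, htime] using hfst
  have hsnd : _ = Pi.single (M := fun _ => ℝ) (0 : Fin n) 1 0 := congrFun (congrArg Prod.snd hv) 0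
  simp [hv₁, Prod.snd_sum, hspace] at hsnd

namespace PointTransf
variable {φ : PointTransf n} {z : VarSpace n} {H : VarSpace n → ℝ}

/-! ### Components of a point transformation -/

lemma fderiv_T (hz : z ∈ φ.map.source) (v : VarSpace n) :
    fderiv ℝ φ.T z v = ((φ.indepDiff z v).1 : ℝ) :=
  fderiv_clm_comp_apply (Complex.ofRealCLM.comp ((ContinuousLinearMap.fst ℝ ℝ (Fin n → ℝ)).comp
    (ContinuousLinearMap.fst ℝ (IndepVar n) ℂ))) (φ.differentiableAt hz) v

lemma fderiv_X (hz : z ∈ φ.map.source) (a : Fin n) (v : VarSpace n) :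
    fderiv ℝ (φ.X a) z v = ((φ.indepDiff z v).2 a : ℝ) :=
  fderiv_clm_comp_apply (Complex.ofRealCLM.comp ((spaceCoord a).comp
    (ContinuousLinearMap.fst ℝ (IndepVar n) ℂ))) (φ.differentiableAt hz) v

lemma fderiv_Psi (hz : z ∈ φ.map.source) (v : VarSpace n) :
    fderiv ℝ φ.Psi z v = (fderiv ℝ φ.map z v).2 :=
  fderiv_clm_comp_apply (ContinuousLinearMap.snd ℝ (IndepVar n) ℂ) (φ.differentiableAt hz) v

lemma fderiv_fderiv_X (hz : z ∈ φ.map.source) (a : Fin n) (u v : VarSpace n) :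
    fderiv ℝ (fderiv ℝ (φ.X a)) z u v = ((fderiv ℝ (fderiv ℝ φ.map) z u v).1.2 a : ℝ) :=
  fderiv_fderiv_clm_comp (Complex.ofRealCLM.comp ((spaceCoord a).comp
    (ContinuousLinearMap.fst ℝ (IndepVar n) ℂ))) (φ.contDiffAt_two hz) u v

lemma fderiv_fderiv_Psi (hz : z ∈ φ.map.source) (u v : VarSpace n) :
    fderiv ℝ (fderiv ℝ φ.Psi) z u v = (fderiv ℝ (fderiv ℝ φ.map) z u v).2 :=
  fderiv_fderiv_clm_comp (ContinuousLinearMap.snd ℝ (IndepVar n) ℂ) (φ.contDiffAt_two hz) u v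

lemma contDiffOn_fderiv : ContDiffOn ℝ ∞ (fderiv ℝ φ.map) φ.map.source :=
  φ.smooth.fderiv_of_isOpen φ.map.open_source (by simp)

lemma clm_fderiv_fderiv_eq_zero {W : Type*} [NormedAddCommGroup W] [NormedSpace ℝ W]
    (A : VarSpace n →L[ℝ] W) {v : VarSpace n} (h : ∀ z ∈ φ.map.source, A (fderiv ℝ φ.map z v) = 0)
    (hz : z ∈ φ.map.source) (u : VarSpace n) :
    A (fderiv ℝ (fderiv ℝ φ.map) z u v) = 0 := by
  have hdiff : DifferentiableAt ℝ (fun y => fderiv ℝ φ.map y v) z :=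
    (differentiableAt_fderiv (φ.contDiffAt_two hz)).clm_apply (differentiableAt_const _)
  have hzero : (fun y => A (fderiv ℝ φ.map y v)) =ᶠ[𝓝 z] fun _ => 0 := by
    filter_upwards [φ.map.open_source.mem_nhds hz] with y hy using h y hy
  rw [← fderiv_fderiv_apply (φ.contDiffAt_two hz) u v, ← fderiv_clm_comp_apply A hdiff u,
    hzero.fderiv_eq]
  simp

lemma fderiv_fderiv_vertical (h : ∀ z ∈ φ.map.source, ∀ w, φ.indepDiff z (0, w) = 0)
    (hz : z ∈ φ.map.source) (u : VarSpace n) (w : ℂ) :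
    (fderiv ℝ (fderiv ℝ φ.map) z u (0, w)).1 = 0 :=
  clm_fderiv_fderiv_eq_zero (ContinuousLinearMap.fst ℝ (IndepVar n) ℂ) (fun z hz => h z hz w) hz u

/-! ### The conformality conditions -/

lemma ConformalEqs.isConformal (h : φ.ConformalEqs H) (hz : z ∈ φ.map.source) :
    IsConformal (φ.indepDiff z) (H z) := by
  obtain ⟨hpos, -, -, hTpsi, hTpsiConj, hTx, hTt, hXpsi, horth⟩ := h.2 z hz
  simp only [dx, dt, fderiv_T hz, fderiv_X hz, Complex.ofReal_eq_zero, ne_eq] at hTx hTt horth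
  refine ⟨hpos, fun w => Prod.ext ?_ (funext fun a => ?_), hTx, hTt, fun b c => ?_⟩
  · have hT := dpsi_eq_zero_and_dpsiConj_eq_zero_iff.1 ⟨hTpsi, hTpsiConj⟩ w
    rwa [fderiv_T hz, Complex.ofReal_eq_zero] at hT
  · have hX := dpsi_eq_zero_and_dpsiConj_eq_zero_iff.1 (hXpsi a) w
    rwa [fderiv_X hz, Complex.ofReal_eq_zero] at hX
  · rw [← Complex.ofReal_inj, apply_ite Complex.ofReal]
    push_cast
    exact horth b c

section ConformalFactor
variable [NeZero n]

lemma exists_clm_conformalFactor_eq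
    (hH : ∀ z ∈ φ.map.source, IsConformal (φ.indepDiff z) (H z)) :
    ∃ L : Fin n → (VarSpace n →L[ℝ] VarSpace n) →L[ℝ] ℝ,
      (∀ a D, L a D = (D (spaceVec a, 0)).1.2 0) ∧
        ∀ z ∈ φ.map.source, H z = ∑ a, L a (fderiv ℝ φ.map z) ^ 2 := by
  refine ⟨fun a => ((spaceCoord 0).comp (ContinuousLinearMap.fst ℝ (IndepVar n) ℂ)).comp
    (ContinuousLinearMap.apply ℝ _ (spaceVec a, 0)), fun a D => rfl, fun z hz => ?_⟩
  have horth := ((hH z hz).orth 0 0).symm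
  simp only [if_true, ← pow_two] at horth
  exact horth

lemma contDiffOn_conformalFactor
    (hH : ∀ z ∈ φ.map.source, IsConformal (φ.indepDiff z) (H z)) :
    ContDiffOn ℝ ∞ H φ.map.source := by
  obtain ⟨L, -, hL⟩ := exists_clm_conformalFactor_eq hH
  refine ContDiffOn.congr ?_ hL
  exact ContDiffOn.sum fun a _ => ((L a).contDiff.comp_contDiffOn contDiffOn_fderiv).pow 2

lemma fderiv_conformalFactor_vertical
    (hH : ∀ z ∈ φ.map.source, IsConformal (φ.indepDiff z) (H z)) (hz : z ∈ φ.map.source) (w : ℂ) :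
    fderiv ℝ (fun y => (H y : ℂ)) z (0, w) = 0 := by
  obtain ⟨L, hL, hHL⟩ := exists_clm_conformalFactor_eq hH
  have hderiv : HasFDerivAt (fun y => ∑ a, L a (fderiv ℝ φ.map y) ^ 2) _ z :=
    HasFDerivAt.fun_sum (u := Finset.univ) fun a _ => ((L a).hasFDerivAt.comp z
      (differentiableAt_fderiv (φ.contDiffAt_two hz)).hasFDerivAt).pow 2
  have hsum : (fun y => (H y : ℂ)) =ᶠ[𝓝 z]
      fun y => Complex.ofRealCLM (∑ a, L a (fderiv ℝ φ.map y) ^ 2) := by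
    filter_upwards [φ.map.open_source.mem_nhds hz] with y hy
    rw [hHL y hy]
    rfl
  have hvertical (a) : L a (fderiv ℝ (fderiv ℝ φ.map) z (0, w)) = 0 := by
    rw [hL, fderiv_fderiv_symm (φ.contDiffAt_two hz),
      fderiv_fderiv_vertical (fun z hz => (hH z hz).vertical) hz]
    rfl
  rw [hsum.fderiv_eq, fderiv_clm_comp_apply _ hderiv.differentiableAt, hderiv.fderiv]
  simp [sum_apply, hvertical]

lemma conformalEqs_of_isConformal
    (hH : ∀ z ∈ φ.map.source, IsConformal (φ.indepDiff z) (H z)) : φ.ConformalEqs H := by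
  refine ⟨contDiffOn_conformalFactor hH, fun z hz => ?_⟩
  have hHz := hH z hz
  obtain ⟨hHpsi, hHpsiConj⟩ :=
    dpsi_eq_zero_and_dpsiConj_eq_zero_iff.2 (fderiv_conformalFactor_vertical hH hz)
  obtain ⟨hTpsi, hTpsiConj⟩ := dpsi_eq_zero_and_dpsiConj_eq_zero_iff.2
    fun w => (fderiv_T hz (0, w)).trans (by simp [hHz.vertical])
  refine ⟨hHz.pos, hHpsi, hHpsiConj, hTpsi, hTpsiConj, fun a => ?_, ?_, fun a =>
    dpsi_eq_zero_and_dpsiConj_eq_zero_iff.2 fun w => (fderiv_X hz a (0, w)).trans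
      (by simp [hHz.vertical]), fun b c => ?_⟩
  · exact (fderiv_T hz _).trans (Complex.ofReal_eq_zero.2 (hHz.space_time a))
  · exact (fderiv_T hz _).trans_ne (Complex.ofReal_ne_zero.2 hHz.time_time)
  · simp only [dx, fderiv_X hz]
    have hbc := congrArg Complex.ofReal (hHz.orth b c)
    rw [apply_ite Complex.ofReal] at hbc
    push_cast at hbc
    exact hbc

end ConformalFactor

/-! ### Transformations between equations are conformal -/

section Conformality
variable {θ θ' : Eqn n} {f g f' g' : IndepVar n → ℂ} {q q' : IndepVar n}

/-- The change of the second derivatives of `ψ̃` caused by a change `w` of those of `ψ` while the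
first derivatives, `l'` for `ψ̃`, are kept. -/
def hessianDiff (φ : PointTransf n) (z : VarSpace n) (l' : IndepVar n →L[ℝ] ℂ) : ℂ →L[ℝ] ℂ :=
  ((ContinuousLinearMap.snd ℝ (IndepVar n) ℂ).comp (fderiv ℝ φ.map z)
    - l'.comp (φ.indepDiff z)).comp (ContinuousLinearMap.inr ℝ (IndepVar n) ℂ)

lemma hessianDiff_apply (φ : PointTransf n) (z : VarSpace n) (l' : IndepVar n →L[ℝ] ℂ) (w : ℂ) :
    φ.hessianDiff z l' w = (fderiv ℝ φ.map z (0, w)).2 - l' (φ.indepDiff z (0, w)) := rfl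

namespace MapsGerm

lemma fderiv_eq_fderiv (hf : φ.MapsGerm f q f' q') (hg : φ.MapsGerm g q g' q')
    (heq : f q = g q) (hfderiv : fderiv ℝ f q = fderiv ℝ g q)
    (hsurj : Function.Surjective fun v => φ.indepDiff (q, f q) (v, fderiv ℝ f q v)) :
    fderiv ℝ f' q' = fderiv ℝ g' q' := by
  refine ContinuousLinearMap.ext fun v => ?_
  obtain ⟨u, rfl⟩ := hsurj v
  have hgu := hg.fderiv_eq u
  rw [← heq, ← hfderiv] at hgu
  exact (hf.fderiv_eq u).symm.trans hgu

lemma fderiv_fderiv_sub (hf : φ.MapsGerm f q f' q') (hg : φ.MapsGerm g q g' q')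
    (heq : f q = g q) (hfderiv : fderiv ℝ f q = fderiv ℝ g q)
    (hfderiv' : fderiv ℝ f' q' = fderiv ℝ g' q') (u v : IndepVar n) :
    fderiv ℝ (fderiv ℝ f') q' (φ.indepDiff (q, f q) (u, fderiv ℝ f q u))
          (φ.indepDiff (q, f q) (v, fderiv ℝ f q v))
        - fderiv ℝ (fderiv ℝ g') q' (φ.indepDiff (q, f q) (u, fderiv ℝ f q u))
          (φ.indepDiff (q, f q) (v, fderiv ℝ f q v)) =
      φ.hessianDiff (q, f q) (fderiv ℝ f' q')
        (fderiv ℝ (fderiv ℝ f) q u v - fderiv ℝ (fderiv ℝ g) q u v) := by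
  have hfuv := hf.fderiv_fderiv_eq u v
  have hguv := hg.fderiv_fderiv_eq u v
  rw [← heq, ← hfderiv, ← hfderiv'] at hguv
  simp only [map_sub, hessianDiff_apply, indepDiff_apply, Prod.snd_add, Prod.fst_add, map_add]
    at hfuv hguv ⊢
  linear_combination hguv - hfuv

lemma sum_fderiv_fderiv_eq_of_symbol_eq (hf : φ.MapsGerm f q f' q') (hg : φ.MapsGerm g q g' q')
    (heq : f q = g q) (hfderiv : fderiv ℝ f q = fderiv ℝ g q)
    (hsurj : Function.Surjective fun v => φ.indepDiff (q, f q) (v, fderiv ℝ f q v))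
    {α β : IndepVar n →L[ℝ] ℝ} (hαβ : symbol spaceVec α = symbol spaceVec β)
    (hdiff : ∀ v, fderiv ℝ (fderiv ℝ f) q v v - fderiv ℝ (fderiv ℝ g) q v v =
      (α (φ.indepDiff (q, f q) (v, fderiv ℝ f q v)) ^ 2
        - β (φ.indepDiff (q, f q) (v, fderiv ℝ f q v)) ^ 2 : ℝ)) :
    ∑ a, fderiv ℝ (fderiv ℝ f') q' (spaceVec a) (spaceVec a) =
      ∑ a, fderiv ℝ (fderiv ℝ g') q' (spaceVec a) (spaceVec a) := by
  choose v hv using fun a => hsurj (spaceVec a)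
  have hfderiv' := hf.fderiv_eq_fderiv hg heq hfderiv hsurj
  have hsub (a) := hf.fderiv_fderiv_sub hg heq hfderiv hfderiv' (v a) (v a)
  simp only at hv
  simp only [hdiff, hv] at hsub
  rw [← sub_eq_zero, ← Finset.sum_sub_distrib, Finset.sum_congr rfl fun a _ => hsub a, ← map_sum,
    ← Complex.ofReal_sum, Finset.sum_sub_distrib]
  have hsymbol : ∑ a, α (spaceVec a) ^ 2 = ∑ a, β (spaceVec a) ^ 2 := hαβ
  simp [hsymbol]

end MapsGerm

lemma MapsEqn.sum_fderiv_fderiv_eq (h : φ.MapsEqn θ θ') (hf : φ.MapsGerm f q f' q')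
    (hg : φ.MapsGerm g q g' q') (hq : (q, f q) ∈ θ.base) (heq : f q = g q)
    (hfderiv : fderiv ℝ f q = fderiv ℝ g q) (hfderiv' : fderiv ℝ f' q' = fderiv ℝ g' q')
    (htrace' : ∑ a, fderiv ℝ (fderiv ℝ f') q' (spaceVec a) (spaceVec a) =
      ∑ a, fderiv ℝ (fderiv ℝ g') q' (spaceVec a) (spaceVec a))
    (hsolved : θ.SolvedAt f q) (hG : θ.G (jet f q) ≠ 0) :
    ∑ a, fderiv ℝ (fderiv ℝ f) q (spaceVec a) (spaceVec a) =
      ∑ a, fderiv ℝ (fderiv ℝ g) q (spaceVec a) (spaceVec a) := by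
  have hf2 := contDiffAt_two_of_infty hf.1
  have hg2 := contDiffAt_two_of_infty hg.1
  have heq' : f' q' = g' q' := by
    have hmap := hf.2.2.2.1.symm.trans ((by rw [heq]) : φ.map (q, f q) = φ.map (q, g q))
    exact congrArg Prod.snd (hmap.trans hg.2.2.2.1)
  have hsolved' : θ'.SolvedAt g' q' :=
    (Eqn.solvedAt_congr (contDiffAt_two_of_infty hf.2.1) (contDiffAt_two_of_infty hg.2.1)
      heq' hfderiv' htrace').1 ((h.2.2 f q f' q' hf hq).1 hsolved)
  have hsolvedg := (h.2.2 g q g' q' hg (heq ▸ hq)).2 hsolved'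
  have hjet : jet g q = jet f q := by rw [jet_eq, jet_eq, heq, hfderiv]
  have heqf := ((Eqn.solvedAt_iff hf2).1 hsolved).2
  have heqg := ((Eqn.solvedAt_iff hg2).1 hsolvedg).2
  rw [hjet, ← hfderiv] at heqg
  exact mul_left_cancel₀ hG (by linear_combination heqf - heqg)

lemma exists_symm_bilinear_solvedAt [NeZero n] {l : IndepVar n →L[ℝ] ℂ}
    (hdom : (z, fun a => l (spaceVec a)) ∈ θ.dom) (hG : θ.G (z, fun a => l (spaceVec a)) ≠ 0) :
    ∃ B : IndepVar n →L[ℝ] IndepVar n →L[ℝ] ℂ, (∀ u v, B u v = B v u) ∧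
      ∀ f, ContDiffAt ℝ ∞ f z.1 → f z.1 = z.2 → fderiv ℝ f z.1 = l →
        fderiv ℝ (fderiv ℝ f) z.1 = B → θ.SolvedAt f z.1 := by
  set j : JetSpace n := (z, fun a => l (spaceVec a))
  obtain ⟨B, hB, htrace⟩ :=
    exists_symm_bilinear_trace_eq (n := n) (-(Complex.I * l timeVec + θ.F j) / θ.G j)
  refine ⟨B, hB, fun f hf hfz hfl hfB => ?_⟩
  have hjet : jet f z.1 = j := by rw [jet_eq, hfz, hfl]
  refine (Eqn.solvedAt_iff (contDiffAt_two_of_infty hf)).2 ⟨hjet ▸ hdom, ?_⟩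
  rw [hjet, hfl, hfB, htrace]
  field_simp
  ring

lemma MapsEqn.preservesSymbol_of_injective [NeZero n] (h : φ.MapsEqn θ θ')
    {l : IndepVar n →L[ℝ] ℂ} (hdom : (z, fun a => l (spaceVec a)) ∈ θ.dom)
    (hG : θ.G (z, fun a => l (spaceVec a)) ≠ 0)
    (hinj : Function.Injective fun v => φ.indepDiff z (v, l v)) :
    PreservesSymbol fun a => φ.indepDiff z (spaceVec a, l (spaceVec a)) := by
  intro α β hαβ
  -- Adding `(α ∘ L)² - (β ∘ L)²` to the Hessian of a solution does not change the Laplacian of the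
  -- transformed function, so it must not change that of the solution either.
  set j : JetSpace n := (z, fun a => l (spaceVec a))
  have hz : z ∈ θ.base := ⟨j, hdom, rfl⟩
  let L : IndepVar n →L[ℝ] IndepVar n :=
    (φ.indepDiff z).comp ((ContinuousLinearMap.id ℝ _).prod l)
  have hsurj : Function.Surjective L :=
    LinearMap.injective_iff_surjective (f := L.toLinearMap).1 hinj
  let sq (γ : IndepVar n →L[ℝ] ℝ) : IndepVar n →L[ℝ] IndepVar n →L[ℝ] ℂ :=
    (γ.comp L).smulRight ((γ.comp L).smulRight 1)
  have hsq (γ : IndepVar n →L[ℝ] ℝ) (u v : IndepVar n) : sq γ u v = (γ (L u) * γ (L v) : ℝ) := by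
    simp [sq]
  obtain ⟨B, hB, hBsolved⟩ := exists_symm_bilinear_solvedAt hdom hG
  have hB' (u v) : (B + sq α - sq β) u v = (B + sq α - sq β) v u := by
    simp [hsq, hB u v, mul_comm]
  obtain ⟨f, f', hf, hfz, hfl, hfB⟩ := exists_mapsGerm_of_jet (h.1 hz) hinj hB
  obtain ⟨g, g', hg, hgz, hgl, hgB⟩ := exists_mapsGerm_of_jet (h.1 hz) hinj hB'
  have hjet : jet f z.1 = j := by rw [jet_eq, hfz, hfl]
  have heq := hfz.trans hgz.symm
  have hfderiv := hfl.trans hgl.symm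
  have hsurj' : Function.Surjective fun v => φ.indepDiff (z.1, f z.1) (v, fderiv ℝ f z.1 v) := by
    rwa [hfz, hfl]
  have htrace' := hf.sum_fderiv_fderiv_eq_of_symbol_eq hg heq hfderiv hsurj' hαβ.symm fun v => by
    rw [hfB, hgB, hfz, hfl]
    have hLv : φ.indepDiff z (v, l v) = L v := rfl
    simp only [add_apply, sub_apply, hsq, ← pow_two, hLv, Complex.ofReal_sub]
    ring
  have hsum := h.sum_fderiv_fderiv_eq hf hg (by rwa [hfz]) heq hfderiv
    (hf.fderiv_eq_fderiv hg heq hfderiv hsurj') htrace' (hBsolved f hf.1 hfz hfl hfB)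
    (hjet ▸ hG)
  simp only [hfB, hgB, add_apply, sub_apply, hsq, ← pow_two, Finset.sum_sub_distrib,
    Finset.sum_add_distrib, ← Complex.ofReal_sum] at hsum
  refine Complex.ofReal_injective ?_
  change ((∑ a, α (L (spaceVec a)) ^ 2 : ℝ) : ℂ) = (∑ a, β (L (spaceVec a)) ^ 2 : ℝ)
  linear_combination -hsum

lemma MapsEqn.preservesSymbol [NeZero n] (h : φ.MapsEqn θ θ') (hθ : θ ∈ classN n)
    {p : Fin n → ℂ} (hp : (z, p) ∈ θ.dom) :
    PreservesSymbol fun a => φ.indepDiff z (spaceVec a, p a) := by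
  have hz : z ∈ φ.map.source := h.1 ⟨_, hp, rfl⟩
  let e : (IndepVar n →L[ℝ] ℂ) →L[ℝ] (Fin n → ℂ) :=
    ContinuousLinearMap.pi fun a => ContinuousLinearMap.apply ℝ ℂ (spaceVec a)
  have he : Function.Surjective e := fun p => by
    obtain ⟨l, -, hl⟩ := exists_linear_apply_timeVec_apply_spaceVec 0 p
    exact ⟨l, funext hl⟩
  have hdense := he.denseRange.dense_image e.continuous
    (dense_setOf_injective_on_graph (φ.indepDiff_surjective hz))
  refine closure_minimal ?_ (isClosed_setOf_preservesSymbol _)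
    (hdense.open_subset_closure_inter (hθ.1.preimage (Continuous.prodMk_right z)) hp)
  rintro _ ⟨hdom, l, hl, rfl⟩
  exact h.preservesSymbol_of_injective hdom (hθ.2.2.2.2 _ hdom) hl

lemma MapsEqn.exists_isConformal (h : φ.MapsEqn θ θ') (hn : 2 ≤ n) (hθ : θ ∈ classN n)
    (hz : z ∈ θ.base) : ∃ H, IsConformal (φ.indepDiff z) H := by
  have : NeZero n := ⟨by omega⟩
  have hsource := h.1 hz
  obtain ⟨⟨z, p⟩, hp, rfl⟩ := hz
  have hnear : ∀ᶠ p' in 𝓝 p, PreservesSymbol fun a => φ.indepDiff z (spaceVec a, p' a) := by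
    filter_upwards [(hθ.1.preimage (Continuous.prodMk_right z)).mem_nhds hp] with p' hp'
    exact h.preservesSymbol hθ hp'
  have hvertical := vertical_eq_zero_of_preservesSymbol hn hnear
  refine exists_isConformal_of_preservesSymbol (φ.indepDiff_surjective hsource) hvertical ?_
  have hp' (a) : φ.indepDiff z (spaceVec a, p a) = φ.indepDiff z (spaceVec a, 0) := by
    simp only [apply_eq_of_vertical_eq_zero hvertical (spaceVec a)]
  simpa only [hp'] using h.preservesSymbol hθ hp

lemma MapsEqn.exists_conformalEqs (h : φ.MapsEqn θ θ') (hn : 2 ≤ n) (hθ : θ ∈ classN n)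
    (hsource : φ.map.source = θ.base) : ∃ H, φ.ConformalEqs H := by
  have : NeZero n := ⟨by omega⟩
  have hH (z : VarSpace n) : ∃ H, z ∈ φ.map.source → IsConformal (φ.indepDiff z) H := by
    by_cases hz : z ∈ φ.map.source
    · obtain ⟨H, hH⟩ := h.exists_isConformal hn hθ (hsource ▸ hz)
      exact ⟨H, fun _ => hH⟩
    · exact ⟨0, fun hz' => absurd hz' hz⟩
  choose H hH using hH
  exact ⟨H, conformalEqs_of_isConformal hH⟩

end Conformality

end PointTransf

/-! ### Prolongation of conformal transformations -/

namespace IsConformal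
variable {M : VarSpace n →L[ℝ] IndepVar n} {h : ℝ}

lemma apply_eq (hM : IsConformal M h) (v : IndepVar n) (w : ℂ) : M (v, w) = M (v, 0) := by
  simp only [apply_eq_of_vertical_eq_zero hM.vertical v]

lemma apply_spaceVec (hM : IsConformal M h) (a : Fin n) :
    M (spaceVec a, 0) = ∑ b, (M (spaceVec a, 0)).2 b • spaceVec b := by
  conv_lhs => rw [eq_smul_timeVec_add_sum_smul_spaceVec (M (spaceVec a, 0))]
  rw [hM.space_time, zero_smul, zero_add]

end IsConformal

namespace PointTransf
variable {φ : PointTransf n} {H : VarSpace n → ℝ} {z : VarSpace n}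
  {f f' : IndepVar n → ℂ} {q q' : IndepVar n}

/-- The first prolongation of a transformation satisfying condition (A) with conformal factor `H`:
the new derivatives of `ψ` are `∑ a, (X^b_a / H) D_aΨ`. -/
def prolongJet (φ : PointTransf n) (H : VarSpace n → ℝ) (j : JetSpace n) : JetSpace n :=
  (φ.map j.1, fun b => ∑ a, dx a (φ.X b) j.1 / H j.1 * totalDx a φ.Psi j)

/-- The terms of the right-hand side of condition (C) without `F` and `F*`, as a function of the
point of the jet space and of the value `g` of `G̃`. -/
def lowerTerms (φ : PointTransf n) (H : VarSpace n → ℝ) (j : JetSpace n) (g : ℂ) : ℂ :=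
  - (hatLaplacian φ.Psi j
      + ((n : ℂ) - 2) / 2 * ∑ a, dx a (fun w => (H w : ℂ)) j.1 / H j.1 * totalDx a φ.Psi j)
      * (g / H j.1)
    - Complex.I / dt φ.T j.1 *
      (dt φ.Psi j.1
        - ∑ b, ∑ a, dt (φ.X b) j.1 * (dx a (φ.X b) j.1 / H j.1) * totalDx a φ.Psi j)

lemma contDiffAt_X (hz : z ∈ φ.map.source) (b : Fin n) : ContDiffAt ℝ 2 (φ.X b) z :=
  (Complex.ofRealCLM.comp ((spaceCoord b).comp
    (ContinuousLinearMap.fst ℝ (IndepVar n) ℂ))).contDiff.contDiffAt.comp z (φ.contDiffAt_two hz)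

lemma contDiffAt_Psi (hz : z ∈ φ.map.source) : ContDiffAt ℝ 2 φ.Psi z :=
  (ContinuousLinearMap.snd ℝ (IndepVar n) ℂ).contDiff.contDiffAt.comp z (φ.contDiffAt_two hz)

lemma dx_dx_X (hz : z ∈ φ.map.source) (a b : Fin n) :
    dx a (dx a (φ.X b)) z =
      ((fderiv ℝ (fderiv ℝ φ.map) z (spaceVec a, 0) (spaceVec a, 0)).1.2 b : ℝ) :=
  (fderiv_dx (contDiffAt_X hz b) a _).trans (fderiv_fderiv_X hz b _ _)

lemma dx_dx_X_comm (hz : z ∈ φ.map.source) (a b c : Fin n) :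
    dx a (dx c (φ.X b)) z = dx c (dx a (φ.X b)) z :=
  (fderiv_dx (contDiffAt_X hz b) c _).trans
    ((fderiv_fderiv_symm (contDiffAt_X hz b) _ _).trans (fderiv_dx (contDiffAt_X hz b) a _).symm)

namespace ConformalEqs

lemma ne_zero (h : φ.ConformalEqs H) (hz : z ∈ φ.map.source) : (H z : ℂ) ≠ 0 :=
  Complex.ofReal_ne_zero.2 (h.isConformal hz).pos.ne'

lemma dt_ne_zero (h : φ.ConformalEqs H) (hz : z ∈ φ.map.source) : dt φ.T z ≠ 0 :=
  (h.2 z hz).2.2.2.2.2.2.1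

lemma orth (h : φ.ConformalEqs H) (hz : z ∈ φ.map.source) (b c : Fin n) :
    ∑ a, dx a (φ.X b) z * dx a (φ.X c) z = if b = c then (H z : ℂ) else 0 :=
  (h.2 z hz).2.2.2.2.2.2.2.2 b c

lemma orth_transpose (h : φ.ConformalEqs H) (hz : z ∈ φ.map.source) (a c : Fin n) :
    ∑ b, dx a (φ.X b) z * dx c (φ.X b) z = if a = c then (H z : ℂ) else 0 := by
  let M : Matrix (Fin n) (Fin n) ℂ := Matrix.of fun b a => dx a (φ.X b) z
  have hH := h.ne_zero hz
  have hright : M * ((H z : ℂ)⁻¹ • M.transpose) = 1 := by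
    ext b c
    rw [Matrix.mul_smul, Matrix.smul_apply, Matrix.mul_apply]
    simp only [M, Matrix.of_apply, Matrix.transpose_apply, h.orth hz, Matrix.one_apply]
    split_ifs <;> simp [hH]
  have hleft := congrArg (fun N : Matrix (Fin n) (Fin n) ℂ => N a c) (mul_eq_one_comm.1 hright)
  rw [Matrix.smul_mul, Matrix.smul_apply, Matrix.mul_apply, smul_eq_mul,
    inv_mul_eq_iff_eq_mul₀ hH] at hleft
  simpa [M, Matrix.one_apply] using hleft

lemma totalDx_eq_sum (h : φ.ConformalEqs H) (hm : φ.MapsGerm f q f' q') (a : Fin n) :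
    totalDx a φ.Psi (jet f q) = ∑ b, dx a (φ.X b) (q, f q) * spaceDeriv b f' q' := by
  have hz := hm.2.2.1
  rw [totalDx_eq, fderiv_Psi (z := (jet f q).1) hz]
  change (fderiv ℝ φ.map (q, f q) (spaceVec a, fderiv ℝ f q (spaceVec a))).2 = _
  rw [hm.fderiv_eq, (h.isConformal hz).apply_eq, (h.isConformal hz).apply_spaceVec, map_sum]
  refine Finset.sum_congr rfl fun b _ => ?_
  rw [map_smul, dx, fderiv_X hz, Complex.real_smul]
  rfl

lemma dt_eq_sum (h : φ.ConformalEqs H) (hm : φ.MapsGerm f q f' q') :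
    dt φ.Psi (q, f q) + (dpsi φ.Psi (q, f q) * timeDeriv f q
        + dpsiConj φ.Psi (q, f q) * conj (timeDeriv f q)) =
      dt φ.T (q, f q) * timeDeriv f' q' + ∑ b, dt (φ.X b) (q, f q) * spaceDeriv b f' q' := by
  have hz := hm.2.2.1
  have hsplit : ((timeVec, fderiv ℝ f q timeVec) : VarSpace n) =
      (timeVec, 0) + (0, fderiv ℝ f q timeVec) := by simp
  have hfderiv := hm.fderiv_eq timeVec
  rw [← fderiv_Psi hz, (h.isConformal hz).apply_eq, hsplit, map_add, fderiv_vertical,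
    eq_smul_timeVec_add_sum_smul_spaceVec (φ.indepDiff (q, f q) (timeVec, 0)), map_add, map_sum,
    map_smul] at hfderiv
  simp only [map_smul, Complex.real_smul, ← fderiv_T hz, ← fderiv_X hz] at hfderiv
  exact hfderiv

lemma spaceDeriv_eq (h : φ.ConformalEqs H) (hm : φ.MapsGerm f q f' q') (b : Fin n) :
    spaceDeriv b f' q' =
      ∑ a, dx a (φ.X b) (q, f q) / H (q, f q) * totalDx a φ.Psi (jet f q) := by
  have hz := hm.2.2.1
  have hsum : ∑ a, dx a (φ.X b) (q, f q) * totalDx a φ.Psi (jet f q) =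
      H (q, f q) * spaceDeriv b f' q' := by
    simp only [h.totalDx_eq_sum hm, Finset.mul_sum]
    rw [Finset.sum_comm]
    simp only [← mul_assoc, ← Finset.sum_mul, h.orth hz]
    simp
  simp only [div_mul_eq_mul_div, ← Finset.sum_div, hsum]
  exact (mul_div_cancel_left₀ _ (h.ne_zero hz)).symm

lemma jet_eq (h : φ.ConformalEqs H) (hm : φ.MapsGerm f q f' q') :
    jet f' q' = φ.prolongJet H (jet f q) :=
  Prod.ext hm.2.2.2.1.symm (funext (h.spaceDeriv_eq hm))

lemma fst_fderiv_fderiv (h : φ.ConformalEqs H) (hz : z ∈ φ.map.source) (v : IndepVar n) (w : ℂ) :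
    (fderiv ℝ (fderiv ℝ φ.map) z (v, w) (v, w)).1 =
      (fderiv ℝ (fderiv ℝ φ.map) z (v, 0) (v, 0)).1 := by
  have hsplit : ((v, w) : VarSpace n) = (v, 0) + (0, w) := by simp
  have hvertical := fderiv_fderiv_vertical (fun z hz => (h.isConformal hz).vertical) hz
  rw [hsplit, map_add (fderiv ℝ (fderiv ℝ φ.map) z), add_apply, map_add, map_add,
    fderiv_fderiv_symm (φ.contDiffAt_two hz) (0, w) (v, 0)]
  simp only [Prod.fst_add, hvertical, add_zero]

lemma fderiv_fderiv_space_time (h : φ.ConformalEqs H) (hz : z ∈ φ.map.source)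
    (a : Fin n) (u : VarSpace n) :
    (fderiv ℝ (fderiv ℝ φ.map) z u (spaceVec a, 0)).1.1 = 0 :=
  clm_fderiv_fderiv_eq_zero ((ContinuousLinearMap.fst ℝ ℝ (Fin n → ℝ)).comp
    (ContinuousLinearMap.fst ℝ (IndepVar n) ℂ)) (fun _ hy => (h.isConformal hy).space_time a) hz u

lemma fderiv_fderiv_Psi_eq_sum (h : φ.ConformalEqs H) (hm : φ.MapsGerm f q f' q') (a : Fin n) :
    fderiv ℝ (fderiv ℝ φ.Psi) (q, f q) (spaceVec a, fderiv ℝ f q (spaceVec a))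
        (spaceVec a, fderiv ℝ f q (spaceVec a))
      + (dpsi φ.Psi (q, f q) * fderiv ℝ (fderiv ℝ f) q (spaceVec a) (spaceVec a)
        + dpsiConj φ.Psi (q, f q) * conj (fderiv ℝ (fderiv ℝ f) q (spaceVec a) (spaceVec a))) =
      ∑ b, ∑ c, dx a (φ.X b) (q, f q) * dx a (φ.X c) (q, f q)
          * fderiv ℝ (fderiv ℝ f') q' (spaceVec b) (spaceVec c)
        + ∑ b, dx a (dx a (φ.X b)) (q, f q) * spaceDeriv b f' q' := by
  have hz := hm.2.2.1
  have hsecond := hm.fderiv_fderiv_eq (spaceVec a) (spaceVec a)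
  rw [Prod.snd_add, ← fderiv_Psi hz, fderiv_vertical, ← fderiv_fderiv_Psi hz, Prod.fst_add,
    ← indepDiff_apply, (h.isConformal hz).vertical, add_zero, (h.isConformal hz).apply_eq,
    (h.isConformal hz).apply_spaceVec, h.fst_fderiv_fderiv hz,
    eq_smul_timeVec_add_sum_smul_spaceVec
      (fderiv ℝ (fderiv ℝ φ.map) (q, f q) (spaceVec a, 0) (spaceVec a, 0)).1,
    h.fderiv_fderiv_space_time hz, zero_smul, zero_add] at hsecond
  rw [hsecond]
  simp only [map_sum, map_smul, sum_apply, smul_apply, Complex.real_smul, ← dx_dx_X hz,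
    ← fderiv_X hz, Finset.mul_sum]
  congr 1
  rw [Finset.sum_comm]
  simp only [mul_left_comm, ← mul_assoc]
  rfl

lemma hatLaplacian_eq_sum (h : φ.ConformalEqs H) (hm : φ.MapsGerm f q f' q') :
    hatLaplacian φ.Psi (jet f q)
        + (dpsi φ.Psi (q, f q) * ∑ a, spaceDeriv a (spaceDeriv a f) q
          + dpsiConj φ.Psi (q, f q) * conj (∑ a, spaceDeriv a (spaceDeriv a f) q)) =
      H (q, f q) * ∑ b, spaceDeriv b (spaceDeriv b f') q'
        + ∑ a, ∑ b, dx a (dx a (φ.X b)) (q, f q) * spaceDeriv b f' q' := by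
  have hz := hm.2.2.1
  have hhat : hatLaplacian φ.Psi (jet f q) = ∑ a, fderiv ℝ (fderiv ℝ φ.Psi) (q, f q)
      (spaceVec a, fderiv ℝ f q (spaceVec a)) (spaceVec a, fderiv ℝ f q (spaceVec a)) :=
    hatLaplacian_eq (contDiffAt_Psi hz) _
  have horth : ∑ a, ∑ b, ∑ c, dx a (φ.X b) (q, f q) * dx a (φ.X c) (q, f q)
        * fderiv ℝ (fderiv ℝ f') q' (spaceVec b) (spaceVec c) =
      H (q, f q) * ∑ b, fderiv ℝ (fderiv ℝ f') q' (spaceVec b) (spaceVec b) := by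
    rw [Finset.sum_comm, Finset.mul_sum]
    refine Finset.sum_congr rfl fun b _ => ?_
    rw [Finset.sum_comm]
    simp only [← Finset.sum_mul, h.orth hz]
    simp
  simp only [spaceDeriv_spaceDeriv (contDiffAt_two_of_infty hm.1),
    spaceDeriv_spaceDeriv (contDiffAt_two_of_infty hm.2.1)]
  rw [hhat, map_sum, Finset.mul_sum, Finset.mul_sum, ← Finset.sum_add_distrib,
    ← Finset.sum_add_distrib, Finset.sum_congr rfl fun a _ => h.fderiv_fderiv_Psi_eq_sum hm a,
    Finset.sum_add_distrib, horth]

lemma sum_dx_mul_dx_dx_add (h : φ.ConformalEqs H) (hz : z ∈ φ.map.source) (a c d : Fin n) :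
    ∑ b, (dx a (φ.X b) z * dx d (dx c (φ.X b)) z + dx c (φ.X b) z * dx d (dx a (φ.X b)) z) =
      if a = c then dx d (fun w => (H w : ℂ)) z else 0 := by
  have hdiff (a b : Fin n) : HasFDerivAt (dx a (φ.X b)) (fderiv ℝ (dx a (φ.X b)) z) z :=
    (hasFDerivAt_fderiv_apply (contDiffAt_X hz b) _).differentiableAt.hasFDerivAt
  have hsum := HasFDerivAt.fun_sum (u := Finset.univ) fun b (_ : b ∈ Finset.univ) =>
    (hdiff a b).mul (hdiff c b)
  have horth : (fun y => ∑ b, dx a (φ.X b) y * dx c (φ.X b) y) =ᶠ[𝓝 z]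
      fun y => if a = c then (H y : ℂ) else 0 := by
    filter_upwards [φ.map.open_source.mem_nhds hz] with y hy using h.orth_transpose hy a c
  have heq := DFunLike.congr_fun (hsum.fderiv.symm.trans horth.fderiv_eq) (spaceVec d, 0)
  rw [sum_apply] at heq
  refine heq.trans ?_
  split_ifs
  · rfl
  · simp

/-- The contracted Christoffel symbols of a conformally flat metric. -/
lemma sum_dx_dx (h : φ.ConformalEqs H) (hz : z ∈ φ.map.source) (c : Fin n) :
    ∑ a, ∑ b, dx a (dx a (φ.X b)) z * dx c (φ.X b) z =
      -(((n : ℂ) - 2) / 2 * dx c (fun w => (H w : ℂ)) z) := by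
  have hdiv : ∑ a, ∑ b, (dx a (φ.X b) z * dx a (dx c (φ.X b)) z
        + dx c (φ.X b) z * dx a (dx a (φ.X b)) z) = dx c (fun w => (H w : ℂ)) z := by
    simp [h.sum_dx_mul_dx_dx_add hz]
  have htrace : ∑ a, ∑ b, (dx a (φ.X b) z * dx c (dx a (φ.X b)) z
        + dx a (φ.X b) z * dx c (dx a (φ.X b)) z) = n * dx c (fun w => (H w : ℂ)) z := by
    simp [h.sum_dx_mul_dx_dx_add hz]
  simp only [Finset.sum_add_distrib, dx_dx_X_comm hz _ _ c] at hdiv htrace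
  simp only [mul_comm _ (dx c (φ.X _) z)]
  linear_combination hdiv - htrace / 2

lemma sum_dx_dx_mul_spaceDeriv (h : φ.ConformalEqs H) (hm : φ.MapsGerm f q f' q') :
    ∑ a, ∑ b, dx a (dx a (φ.X b)) (q, f q) * spaceDeriv b f' q' =
      -(((n : ℂ) - 2) / 2 * ∑ a, dx a (fun w => (H w : ℂ)) (q, f q) / H (q, f q)
            * totalDx a φ.Psi (jet f q)) :=
  calc _ = ∑ a, ∑ b, ∑ c, dx a (dx a (φ.X b)) (q, f q) * dx c (φ.X b) (q, f q) *
          (totalDx c φ.Psi (jet f q) / H (q, f q)) := by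
        refine Finset.sum_congr rfl fun a _ => Finset.sum_congr rfl fun b _ => ?_
        rw [h.spaceDeriv_eq hm, Finset.mul_sum]
        exact Finset.sum_congr rfl fun c _ => by ring
    _ = ∑ c, (∑ a, ∑ b, dx a (dx a (φ.X b)) (q, f q) * dx c (φ.X b) (q, f q)) *
          (totalDx c φ.Psi (jet f q) / H (q, f q)) := by
        simp only [Finset.sum_mul]
        rw [Finset.sum_congr rfl fun a _ => Finset.sum_comm, Finset.sum_comm]
    _ = _ := by
        simp only [h.sum_dx_dx hm.2.2.1]
        rw [Finset.mul_sum, ← Finset.sum_neg_distrib]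
        exact Finset.sum_congr rfl fun c _ => by ring

lemma residual_eq (h : φ.ConformalEqs H) (hm : φ.MapsGerm f q f' q') (g k : ℂ) :
    Complex.I * timeDeriv f' q' + g * ∑ b, spaceDeriv b (spaceDeriv b f') q' + k =
      Complex.I / dt φ.T (q, f q) * (dpsi φ.Psi (q, f q) * timeDeriv f q
        + dpsiConj φ.Psi (q, f q) * conj (timeDeriv f q))
      + g / H (q, f q) * (dpsi φ.Psi (q, f q) * ∑ a, spaceDeriv a (spaceDeriv a f) q
          + dpsiConj φ.Psi (q, f q) * conj (∑ a, spaceDeriv a (spaceDeriv a f) q))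
      + (k - φ.lowerTerms H (jet f q) g) := by
  have hz := hm.2.2.1
  have hH := h.ne_zero hz
  have hT := h.dt_ne_zero hz
  have hspace := h.hatLaplacian_eq_sum hm
  rw [h.sum_dx_dx_mul_spaceDeriv hm] at hspace
  have htime := h.dt_eq_sum hm
  have hX : ∑ b, dt (φ.X b) (q, f q) * spaceDeriv b f' q' = ∑ b, ∑ a, dt (φ.X b) (q, f q) *
      (dx a (φ.X b) (q, f q) / H (q, f q)) * totalDx a φ.Psi (jet f q) := by
    simp only [h.spaceDeriv_eq hm, Finset.mul_sum, mul_assoc]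
  rw [hX] at htime
  have hjet : (jet f q).1 = (q, f q) := rfl
  simp only [lowerTerms, hjet]
  linear_combination (norm := skip) (-g / H (q, f q)) * hspace - Complex.I / dt φ.T (q, f q) * htime
  field_simp
  ring

end ConformalEqs
end PointTransf

/-! ### Equations related by a conformal transformation -/

section ConjLinear

/-- The real-linear endomorphism `w ↦ a w + b w*` of `ℂ`; the derivative of `Ψ` along the fibres of
`(t, x, ψ) ↦ (t, x)` is the one with `a = Ψ_ψ` and `b = Ψ_{ψ*}`. -/
def conjLinear (a b : ℂ) : ℂ →L[ℝ] ℂ :=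
  a • ContinuousLinearMap.id ℝ ℂ + b • (Complex.conjCLE : ℂ →L[ℝ] ℂ)

lemma conjLinear_apply (a b w : ℂ) : conjLinear a b w = a * w + b * conj w := by
  simp [conjLinear]

lemma conjLinear_injective_iff {a b : ℂ} :
    Function.Injective (conjLinear a b) ↔ ‖a‖ ≠ ‖b‖ := by
  rw [injective_iff_map_eq_zero]
  refine ⟨fun hinj hnorm => ?_, fun hnorm w hw => ?_⟩
  · have hsq : a * conj a = b * conj b := by simp only [Complex.mul_conj', hnorm]
    have hker (c : ℂ) : conj a * c - b * conj c = 0 := hinj _ <| by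
      simp only [conjLinear_apply, map_sub, map_mul, Complex.conj_conj]
      linear_combination c * hsq
    have hone : conj a - b = 0 := by simpa using hker 1
    have hI : conj a * Complex.I + b * Complex.I = 0 := by simpa using hker Complex.I
    have hb : b = 0 := by
      linear_combination (-hone - Complex.I * hI + (conj a + b) * Complex.I_sq) / 2
    have ha : a = 0 := by simpa [hb] using hone
    exact one_ne_zero (hinj 1 (by simp [conjLinear_apply, ha, hb]))
  · rw [conjLinear_apply] at hw
    have hmul : ‖a‖ * ‖w‖ = ‖b‖ * ‖w‖ := by
      simpa using congrArg norm (eq_neg_of_add_eq_zero_left hw)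
    by_contra hw0
    exact hnorm (mul_right_cancel₀ (norm_ne_zero_iff.2 hw0) hmul)

end ConjLinear

namespace PointTransf
variable {φ : PointTransf n} {θ θ' : Eqn n} {H : VarSpace n → ℝ} {z : VarSpace n}
  {j : JetSpace n} {G F G' F' G'' F'' : ℂ}

/-- The relation between the values `G`, `F` of the arbitrary elements of an equation at the point
`j` of the jet space and the values `G'`, `F'` of those of its image at the image of `j`, given by
conditions (B) and (C). -/
def ArbRel (φ : PointTransf n) (H : VarSpace n → ℝ) (j : JetSpace n) (G F G' F' : ℂ) : Prop :=
  (dpsi φ.Psi j.1 ≠ 0 → G' = H j.1 / dt φ.T j.1 * G) ∧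
  (dpsiConj φ.Psi j.1 ≠ 0 → G' = H j.1 / dt φ.T j.1 * (-conj G)) ∧
  F' = dpsi φ.Psi j.1 / dt φ.T j.1 * F - dpsiConj φ.Psi j.1 / dt φ.T j.1 * conj F
    + φ.lowerTerms H j G'

lemma conj_dt_T (hz : z ∈ φ.map.source) : conj (dt φ.T z) = dt φ.T z := by
  rw [dt, fderiv_T hz, Complex.conj_ofReal]

namespace ConformalEqs

lemma conjLinear_injective (h : φ.ConformalEqs H) (hz : z ∈ φ.map.source) :
    Function.Injective (conjLinear (dpsi φ.Psi z) (dpsiConj φ.Psi z)) := by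
  intro w w' hww
  simp only [conjLinear_apply, ← fderiv_vertical, fderiv_Psi hz] at hww
  have hfst : (fderiv ℝ φ.map z (0, w)).1 = (fderiv ℝ φ.map z (0, w')).1 :=
    ((h.isConformal hz).vertical w).trans ((h.isConformal hz).vertical w').symm
  exact congrArg Prod.snd ((φ.fderiv_bijective hz).1 (Prod.ext hfst hww))

lemma norm_dpsi_ne (h : φ.ConformalEqs H) (hz : z ∈ φ.map.source) :
    ‖dpsi φ.Psi z‖ ≠ ‖dpsiConj φ.Psi z‖ :=
  conjLinear_injective_iff.1 (h.conjLinear_injective hz)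

lemma dpsi_ne_zero_or (h : φ.ConformalEqs H) (hz : z ∈ φ.map.source) :
    dpsi φ.Psi z ≠ 0 ∨ dpsiConj φ.Psi z ≠ 0 := by
  by_contra! hzero
  exact h.norm_dpsi_ne hz (by rw [hzero.1, hzero.2])

lemma exists_mapsGerm [NeZero n] (h : φ.ConformalEqs H) (hj : j.1 ∈ φ.map.source) (τ S : ℂ) :
    ∃ f f', φ.MapsGerm f j.1.1 f' (φ.map j.1).1 ∧ jet f j.1.1 = j ∧
      timeDeriv f j.1.1 = τ ∧ ∑ a, spaceDeriv a (spaceDeriv a f) j.1.1 = S := by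
  obtain ⟨l, hlτ, hlp⟩ := exists_linear_apply_timeVec_apply_spaceVec τ j.2
  obtain ⟨B, hB, htrace⟩ := exists_symm_bilinear_trace_eq (n := n) S
  have hsurj : Function.Surjective fun v => φ.indepDiff j.1 (v, l v) := fun y => by
    obtain ⟨⟨v, w⟩, hv⟩ := φ.indepDiff_surjective hj y
    exact ⟨v, by rw [← hv]; simp only [(h.isConformal hj).apply_eq v]⟩
  have hinj : Function.Injective fun v => φ.indepDiff j.1 (v, l v) :=
    (LinearMap.injective_iff_surjective
      (f := ((φ.indepDiff j.1).comp ((ContinuousLinearMap.id ℝ _).prod l)).toLinearMap)).2 hsurj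
  obtain ⟨f, f', hm, hfz, hfl, hfB⟩ := exists_mapsGerm_of_jet hj hinj hB
  refine ⟨f, f', hm, ?_, ?_, ?_⟩
  · simp only [GenSchr.jet_eq, hfz, hfl, hlp]
  · rw [← hlτ, ← hfl]
    rfl
  · simp only [spaceDeriv_spaceDeriv (contDiffAt_two_of_infty hm.1), hfB, htrace]

end ConformalEqs

lemma arbRel_of_forall_eq_zero (h : φ.ConformalEqs H) (hj : j.1 ∈ φ.map.source)
    (hres : ∀ S : ℂ, Complex.I / dt φ.T j.1 * (dpsi φ.Psi j.1 * (Complex.I * (G * S + F))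
        + dpsiConj φ.Psi j.1 * conj (Complex.I * (G * S + F)))
      + G' / H j.1 * (dpsi φ.Psi j.1 * S + dpsiConj φ.Psi j.1 * conj S)
      + (F' - φ.lowerTerms H j G') = 0) : φ.ArbRel H j G F G' F' := by
  have hH := h.ne_zero hj
  have hzero := hres 0
  have hone := hres 1
  have hI := hres Complex.I
  unfold ArbRel
  simp only [map_mul, map_add, Complex.conj_I, map_zero, map_one] at hzero hone hI
  set A := dpsi φ.Psi j.1
  set B := dpsiConj φ.Psi j.1
  set T := dt φ.T j.1
  have hadd : A * (G' / H j.1 - G / T) + B * (G' / H j.1 + conj G / T) = 0 := by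
    linear_combination hone - hzero + (B * conj G / T - A * G / T) * Complex.I_sq
  have hsub : A * (G' / H j.1 - G / T) - B * (G' / H j.1 + conj G / T) = 0 := by
    linear_combination -Complex.I * (hI - hzero) + (A * (G' / H j.1 - G / T)
      - B * (G' / H j.1 + conj G / T)
      + (A * G / T + B * conj G / T) * Complex.I ^ 2) * Complex.I_sq
  have hA : A * (G' / H j.1 - G / T) = 0 := by linear_combination (hadd + hsub) / 2
  have hB : B * (G' / H j.1 + conj G / T) = 0 := by linear_combination (hadd - hsub) / 2
  refine ⟨fun hA0 => ?_, fun hB0 => ?_, ?_⟩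
  · have hquot := sub_eq_zero.1 ((mul_eq_zero.1 hA).resolve_left hA0)
    rw [(div_eq_iff hH).1 hquot]
    ring
  · have hquot := eq_neg_of_add_eq_zero_left ((mul_eq_zero.1 hB).resolve_left hB0)
    rw [(div_eq_iff hH).1 hquot]
    ring
  · linear_combination hzero - (A / T * F - B / T * conj F) * Complex.I_sq

namespace ArbRel

lemma unique (h₁ : φ.ArbRel H j G F G' F') (h₂ : φ.ArbRel H j G F G'' F'')
    (h : φ.ConformalEqs H) (hj : j.1 ∈ φ.map.source) : G' = G'' ∧ F' = F'' := by
  have hG : G' = G'' := by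
    rcases h.dpsi_ne_zero_or hj with hne | hne
    · rw [h₁.1 hne, h₂.1 hne]
    · rw [h₁.2.1 hne, h₂.2.1 hne]
  exact ⟨hG, by rw [h₁.2.2, h₂.2.2, hG]⟩

lemma conj_eq_neg_iff (hr : φ.ArbRel H j G F G' F') (h : φ.ConformalEqs H)
    (hj : j.1 ∈ φ.map.source) : conj G' = -G' ↔ conj G = -G := by
  have hk : (H j.1 : ℂ) / dt φ.T j.1 ≠ 0 := div_ne_zero (h.ne_zero hj) (h.dt_ne_zero hj)
  have hconj : conj ((H j.1 : ℂ) / dt φ.T j.1) = (H j.1 : ℂ) / dt φ.T j.1 := by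
    rw [map_div₀, Complex.conj_ofReal, conj_dt_T hj]
  rcases h.dpsi_ne_zero_or hj with hne | hne
  · rw [hr.1 hne, map_mul, hconj, ← mul_neg]
    exact mul_right_inj' hk
  · rw [hr.2.1 hne, map_mul, hconj, ← mul_neg, mul_right_inj' hk, map_neg, Complex.conj_conj,
      neg_neg]
    exact eq_comm

lemma dpsi_mul_dpsiConj_eq_zero (hr : φ.ArbRel H j G F G' F') (h : φ.ConformalEqs H)
    (hj : j.1 ∈ φ.map.source) (hG : conj G ≠ -G) : dpsi φ.Psi j.1 * dpsiConj φ.Psi j.1 = 0 := by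
  by_contra hne
  obtain ⟨hA, hB⟩ := mul_ne_zero_iff.1 hne
  have heq := (hr.1 hA).symm.trans (hr.2.1 hB)
  rw [mul_right_inj' (div_ne_zero (h.ne_zero hj) (h.dt_ne_zero hj))] at heq
  exact hG (neg_eq_iff_eq_neg.1 heq.symm)

lemma residual_eq (hr : φ.ArbRel H j G F G' F') (h : φ.ConformalEqs H)
    (hj : j.1 ∈ φ.map.source) (τ S : ℂ) :
    Complex.I / dt φ.T j.1 * (dpsi φ.Psi j.1 * τ + dpsiConj φ.Psi j.1 * conj τ)
      + G' / H j.1 * (dpsi φ.Psi j.1 * S + dpsiConj φ.Psi j.1 * conj S)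
      + (F' - φ.lowerTerms H j G') =
    -(Complex.I / dt φ.T j.1) * conjLinear (dpsi φ.Psi j.1) (dpsiConj φ.Psi j.1)
      (Complex.I * (Complex.I * τ + G * S + F)) := by
  have hH := h.ne_zero hj
  have hT := h.dt_ne_zero hj
  obtain ⟨hGA, hGB, hF⟩ := hr
  rw [hF]
  set A := dpsi φ.Psi j.1
  set B := dpsiConj φ.Psi j.1
  set T := dt φ.T j.1
  have hA : A * (G' / H j.1) = A * (G / T) := by
    by_cases hA0 : A = 0
    · simp [hA0]
    · rw [hGA hA0]
      field_simp
  have hB : B * (G' / H j.1) = -(B * (conj G / T)) := by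
    by_cases hB0 : B = 0
    · simp [hB0]
    · rw [hGB hB0]
      field_simp
  simp only [conjLinear_apply, map_mul, map_add, Complex.conj_I]
  linear_combination S * hA + conj S * hB + ((A * F - B * conj F) / T
    + (A * G * S - B * conj G * conj S) / T + (A * τ + B * conj τ) * Complex.I / T) * Complex.I_sq

end ArbRel

namespace MapsEqn

lemma mem_dom_and_arbRel [NeZero n] (hm : φ.MapsEqn θ θ') (h : φ.ConformalEqs H)
    (hj : j ∈ θ.dom) : φ.prolongJet H j ∈ θ'.dom ∧
      φ.ArbRel H j (θ.G j) (θ.F j) (θ'.G (φ.prolongJet H j)) (θ'.F (φ.prolongJet H j)) := by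
  have hbase : j.1 ∈ θ.base := ⟨j, hj, rfl⟩
  have hsource := hm.1 hbase
  have key (S : ℂ) : φ.prolongJet H j ∈ θ'.dom ∧
      Complex.I / dt φ.T j.1 * (dpsi φ.Psi j.1 * (Complex.I * (θ.G j * S + θ.F j))
        + dpsiConj φ.Psi j.1 * conj (Complex.I * (θ.G j * S + θ.F j)))
      + θ'.G (φ.prolongJet H j) / H j.1 * (dpsi φ.Psi j.1 * S + dpsiConj φ.Psi j.1 * conj S)
      + (θ'.F (φ.prolongJet H j) - φ.lowerTerms H j (θ'.G (φ.prolongJet H j))) = 0 := by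
    obtain ⟨f, f', hg, hjet, hτ, hS⟩ :=
      h.exists_mapsGerm hsource (Complex.I * (θ.G j * S + θ.F j)) S
    have hf : (j.1.1, f j.1.1) = j.1 := congrArg Prod.fst hjet
    have hsol : θ.SolvedAt f j.1.1 := by
      refine ⟨hjet ▸ hj, ?_⟩
      rw [hjet, hτ, hS]
      linear_combination (θ.G j * S + θ.F j) * Complex.I_sq
    have hsol' := (hm.2.2 _ _ _ _ hg (by rwa [hf])).1 hsol
    have hres := h.residual_eq hg (θ'.G (φ.prolongJet H j)) (θ'.F (φ.prolongJet H j))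
    rw [Eqn.SolvedAt, h.jet_eq hg, hjet] at hsol'
    rw [hsol'.2, hf, hτ, hS, hjet] at hres
    exact ⟨hsol'.1, hres.symm⟩
  exact ⟨(key 0).1, arbRel_of_forall_eq_zero h hsource fun S => (key S).2⟩

lemma mem_dom_of_prolongJet_mem_dom [NeZero n] (hm : φ.MapsEqn θ θ') (h : φ.ConformalEqs H)
    (hbase : j.1 ∈ θ.base) (hj : φ.prolongJet H j ∈ θ'.dom) : j ∈ θ.dom := by
  have hsource := hm.1 hbase
  have hT := h.dt_ne_zero hsource
  set G' := θ'.G (φ.prolongJet H j)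
  set F' := θ'.F (φ.prolongJet H j)
  obtain ⟨τ, hτ⟩ := LinearMap.injective_iff_surjective.1 (h.conjLinear_injective hsource)
    (Complex.I * dt φ.T j.1 * (F' - φ.lowerTerms H j G'))
  rw [ContinuousLinearMap.coe_coe, conjLinear_apply] at hτ
  obtain ⟨f, f', hg, hjet, hfτ, hfS⟩ := h.exists_mapsGerm hsource τ 0
  have hf : (j.1.1, f j.1.1) = j.1 := congrArg Prod.fst hjet
  have hres := h.residual_eq hg G' F'
  rw [hf, hfτ, hfS, hjet, hτ] at hres
  have hsol' : θ'.SolvedAt f' (φ.map j.1).1 := by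
    rw [Eqn.SolvedAt, h.jet_eq hg, hjet]
    refine ⟨hj, hres.trans ?_⟩
    rw [map_zero]
    field_simp
    linear_combination (F' - φ.lowerTerms H j G') * Complex.I_sq
  exact hjet ▸ ((hm.2.2 _ _ _ _ hg (by rwa [hf])).2 hsol').1

lemma image_prolongJet_dom [NeZero n] (hm : φ.MapsEqn θ θ') (h : φ.ConformalEqs H)
    (hsurj : ∀ j' : JetSpace n, j'.1 ∈ φ.map.target →
      ∃ j : JetSpace n, j.1 ∈ φ.map.source ∧ φ.prolongJet H j = j') :
    φ.prolongJet H '' θ.dom = θ'.dom := by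
  refine Subset.antisymm ?_ fun j' hj' => ?_
  · rintro _ ⟨j, hj, rfl⟩
    exact (hm.mem_dom_and_arbRel h hj).1
  · obtain ⟨z, hz, hzj⟩ : j'.1 ∈ φ.map '' θ.base := hm.2.1 ▸ ⟨j', hj', rfl⟩
    obtain ⟨j, hj, rfl⟩ := hsurj j' (hzj ▸ φ.map.map_source (hm.1 hz))
    have hjz : j.1 = z := φ.map.injOn hj (hm.1 hz) hzj.symm
    exact ⟨j, hm.mem_dom_of_prolongJet_mem_dom h (hjz ▸ hz) hj', rfl⟩

end MapsEqn

lemma ConformalEqs.mapsEqn (h : φ.ConformalEqs H) (hbase : θ.base ⊆ φ.map.source)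
    (hinj : InjOn (φ.prolongJet H) (Prod.fst ⁻¹' φ.map.source))
    (hdom : θ'.dom = φ.prolongJet H '' θ.dom)
    (hrel : ∀ j ∈ θ.dom,
      φ.ArbRel H j (θ.G j) (θ.F j) (θ'.G (φ.prolongJet H j)) (θ'.F (φ.prolongJet H j))) :
    φ.MapsEqn θ θ' := by
  refine ⟨hbase, ?_, fun f q f' q' hg hq => ?_⟩
  · rw [Eqn.base, Eqn.base, hdom, image_image, image_image]
    rfl
  · have hz : (jet f q).1 ∈ φ.map.source := hbase hq
    have hmem : φ.prolongJet H (jet f q) ∈ θ'.dom ↔ jet f q ∈ θ.dom := by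
      refine ⟨fun hj => ?_, fun hj => hdom ▸ mem_image_of_mem _ hj⟩
      rw [hdom] at hj
      obtain ⟨j, hj, hjeq⟩ := hj
      rwa [← hinj (hbase ⟨j, hj, rfl⟩) hz hjeq]
    rw [Eqn.SolvedAt, Eqn.SolvedAt, h.jet_eq hg, hmem]
    refine and_congr_right fun hj => ?_
    have hfactor : -(Complex.I / dt φ.T (jet f q).1) ≠ 0 :=
      neg_ne_zero.2 (div_ne_zero Complex.I_ne_zero (h.dt_ne_zero hz))
    rw [(h.residual_eq hg _ _).trans ((hrel _ hj).residual_eq h hz _ _), mul_eq_zero,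
      or_iff_right hfactor, map_eq_zero_iff _ (h.conjLinear_injective hz), mul_eq_zero,
      or_iff_right Complex.I_ne_zero]

end PointTransf

/-! ### Prolongation to the arbitrary elements -/

section AffineSkewProduct
variable {E V : Type*} [NormedAddCommGroup E] [NormedSpace ℝ E] [NormedAddCommGroup V]
  [NormedSpace ℝ V]

lemma contDiffOn_affineSkewProduct {φ : E → E} {s : Set E} {A : E → V →L[ℝ] V} {c : E → V}
    (hφ : ContDiffOn ℝ ∞ φ s) (hA : ContDiffOn ℝ ∞ A s) (hc : ContDiffOn ℝ ∞ c s) (U : Set V) :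
    ContDiffOn ℝ ∞ (fun x : E × V => (φ x.1, A x.1 x.2 + c x.1)) (s ×ˢ U) := by
  have hfst : MapsTo Prod.fst (s ×ˢ U) s := fun x hx => hx.1
  exact (hφ.comp contDiffOn_fst hfst).prodMk
    (((hA.comp contDiffOn_fst hfst).clm_apply contDiffOn_snd).add (hc.comp contDiffOn_fst hfst))

lemma isInvertible_of_injective [FiniteDimensional ℝ V] {A : V →L[ℝ] V}
    (hA : Function.Injective A) : A.IsInvertible :=
  ⟨(LinearEquiv.ofInjectiveEndo A.toLinearMap hA).toContinuousLinearEquiv, rfl⟩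

lemma exists_affineSkewProduct [FiniteDimensional ℝ V]
    {φ : OpenPartialHomeomorph E E} (hφ : ContDiffOn ℝ ∞ φ φ.source)
    (hφ' : ContDiffOn ℝ ∞ φ.symm φ.target) {U : Set V} (hU : IsOpen U) {A : E → V →L[ℝ] V}
    {c : E → V} (hA : ∀ v, ContDiffOn ℝ ∞ (fun z => A z v) φ.source)
    (hc : ContDiffOn ℝ ∞ c φ.source) (hinj : ∀ z ∈ φ.source, Function.Injective (A z))
    (hAU : ∀ z ∈ φ.source, ∀ v, A z v + c z ∈ U ↔ v ∈ U) :
    ∃ Φ : OpenPartialHomeomorph (E × V) (E × V), Φ.source = φ.source ×ˢ U ∧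
      Φ.target = φ.target ×ˢ U ∧ (∀ x, Φ x = (φ x.1, A x.1 x.2 + c x.1)) ∧
      ContDiffOn ℝ ∞ Φ Φ.source ∧ ContDiffOn ℝ ∞ Φ.symm Φ.target := by
  have hinv : ∀ z ∈ φ.source, (A z).IsInvertible := fun z hz =>
    isInvertible_of_injective (hinj z hz)
  have hAsmooth : ContDiffOn ℝ ∞ A φ.source := contDiffOn_clm_apply.2 hA
  have hAinv : ContDiffOn ℝ ∞ (fun z => (A z).inverse) φ.source := fun z hz =>
    (hinv z hz).contDiffAt_map_inverse.comp_contDiffWithinAt z (hAsmooth z hz)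
  have hto := contDiffOn_affineSkewProduct hφ hAsmooth hc U
  have hfrom : ContDiffOn ℝ ∞ (fun x : E × V =>
      (φ.symm x.1, (A (φ.symm x.1)).inverse (x.2 - c (φ.symm x.1)))) (φ.target ×ˢ U) :=
    (contDiffOn_affineSkewProduct hφ' (hAinv.comp hφ' φ.symm.mapsTo)
      ((hAinv.clm_apply hc).neg.comp hφ' φ.symm.mapsTo) U).congr fun x _ => by
        simp [sub_eq_add_neg]
  let Φ : OpenPartialHomeomorph (E × V) (E × V) :=
    { toFun := fun x => (φ x.1, A x.1 x.2 + c x.1)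
      invFun := fun x => (φ.symm x.1, (A (φ.symm x.1)).inverse (x.2 - c (φ.symm x.1)))
      source := φ.source ×ˢ U
      target := φ.target ×ˢ U
      map_source' := fun x hx => ⟨φ.map_source hx.1, (hAU _ hx.1 _).2 hx.2⟩
      map_target' := fun x hx => by
        have hz := φ.map_target hx.1
        refine ⟨hz, (hAU _ hz _).1 ?_⟩
        rw [(hinv _ hz).self_apply_inverse, sub_add_cancel]
        exact hx.2
      left_inv' := fun x hx => by
        simp [φ.left_inv hx.1, (hinv _ hx.1).inverse_apply_self]
      right_inv' := fun x hx => by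
        simp [φ.right_inv hx.1, (hinv _ (φ.map_target hx.1)).self_apply_inverse]
      open_source := φ.open_source.prod hU
      open_target := φ.open_target.prod hU
      continuousOn_toFun := hto.continuousOn
      continuousOn_invFun := hfrom.continuousOn }
  exact ⟨Φ, rfl, rfl, fun _ => rfl, hto, hfrom⟩

end AffineSkewProduct

section Smooth
variable {E : Type*} [NormedAddCommGroup E] [NormedSpace ℝ E] {S : Set E} {a b : E → ℂ}

lemma contDiffOn_conj (ha : ContDiffOn ℝ ∞ a S) : ContDiffOn ℝ ∞ (fun x => conj (a x)) S :=
  Complex.conjCLE.contDiff.comp_contDiffOn ha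

lemma contDiffOn_div (ha : ContDiffOn ℝ ∞ a S) (hb : ContDiffOn ℝ ∞ b S)
    (hb0 : ∀ x ∈ S, b x ≠ 0) : ContDiffOn ℝ ∞ (fun x => a x / b x) S := by
  simp only [div_eq_mul_inv]
  exact ha.mul (hb.inv hb0)

lemma contDiffOn_conjLinear (ha : ContDiffOn ℝ ∞ a S) (hb : ContDiffOn ℝ ∞ b S) :
    ContDiffOn ℝ ∞ (fun x => conjLinear (a x) (b x)) S :=
  (ha.smul contDiffOn_const).add (hb.smul contDiffOn_const)

variable {f : VarSpace n → ℂ} {s : Set (VarSpace n)}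

lemma contDiffOn_fderiv_apply (hs : IsOpen s) (hf : ContDiffOn ℝ ∞ f s) (v : VarSpace n) :
    ContDiffOn ℝ ∞ (fun z => fderiv ℝ f z v) s :=
  (hf.fderiv_of_isOpen hs (by simp)).clm_apply contDiffOn_const

lemma contDiffOn_dt (hs : IsOpen s) (hf : ContDiffOn ℝ ∞ f s) : ContDiffOn ℝ ∞ (dt f) s :=
  contDiffOn_fderiv_apply hs hf _

lemma contDiffOn_dx (hs : IsOpen s) (hf : ContDiffOn ℝ ∞ f s) (a : Fin n) :
    ContDiffOn ℝ ∞ (dx a f) s :=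
  contDiffOn_fderiv_apply hs hf _

lemma contDiffOn_dpsi (hs : IsOpen s) (hf : ContDiffOn ℝ ∞ f s) : ContDiffOn ℝ ∞ (dpsi f) s :=
  ((contDiffOn_fderiv_apply hs hf _).sub
    (contDiffOn_const.mul (contDiffOn_fderiv_apply hs hf _))).div_const 2

lemma contDiffOn_dpsiConj (hs : IsOpen s) (hf : ContDiffOn ℝ ∞ f s) :
    ContDiffOn ℝ ∞ (dpsiConj f) s :=
  ((contDiffOn_fderiv_apply hs hf _).add
    (contDiffOn_const.mul (contDiffOn_fderiv_apply hs hf _))).div_const 2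

lemma contDiffOn_comp_fst {g : VarSpace n → ℂ} (hg : ContDiffOn ℝ ∞ g s) :
    ContDiffOn ℝ ∞ (fun j : JetSpace n => g j.1) (Prod.fst ⁻¹' s) :=
  hg.comp contDiffOn_fst fun _ hj => hj

lemma contDiffOn_jet_snd (a : Fin n) {s : Set (JetSpace n)} :
    ContDiffOn ℝ ∞ (fun j : JetSpace n => j.2 a) s :=
  ((ContinuousLinearMap.proj (R := ℝ) (φ := fun _ : Fin n => ℂ) a).comp
    (ContinuousLinearMap.snd ℝ (VarSpace n) (Fin n → ℂ))).contDiff.contDiffOn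

lemma contDiffOn_totalDx (hs : IsOpen s) (hf : ContDiffOn ℝ ∞ f s) (a : Fin n) :
    ContDiffOn ℝ ∞ (totalDx a f) (Prod.fst ⁻¹' s) :=
  ((contDiffOn_comp_fst (contDiffOn_dx hs hf a)).add
    ((contDiffOn_jet_snd a).mul (contDiffOn_comp_fst (contDiffOn_dpsi hs hf)))).add
    ((contDiffOn_conj (contDiffOn_jet_snd a)).mul (contDiffOn_comp_fst (contDiffOn_dpsiConj hs hf)))

lemma contDiffOn_hatLaplacian (hs : IsOpen s) (hf : ContDiffOn ℝ ∞ f s) :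
    ContDiffOn ℝ ∞ (hatLaplacian f) (Prod.fst ⁻¹' s) := by
  have hA := contDiffOn_dpsi hs hf
  have hB := contDiffOn_dpsiConj hs hf
  refine ContDiffOn.sum fun a _ => ?_
  have hp := contDiffOn_jet_snd a (s := Prod.fst ⁻¹' s)
  have hpc := contDiffOn_conj hp
  exact (((((contDiffOn_comp_fst (contDiffOn_dx hs (contDiffOn_dx hs hf a) a)).add
    ((contDiffOn_const.mul hp).mul (contDiffOn_comp_fst (contDiffOn_dx hs hA a)))).add
    ((contDiffOn_const.mul hpc).mul (contDiffOn_comp_fst (contDiffOn_dx hs hB a)))).add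
    ((hp.pow 2).mul (contDiffOn_comp_fst (contDiffOn_dpsi hs hA)))).add
    (((contDiffOn_const.mul hp).mul hpc).mul (contDiffOn_comp_fst (contDiffOn_dpsi hs hB)))).add
    ((hpc.pow 2).mul (contDiffOn_comp_fst (contDiffOn_dpsiConj hs hB)))

end Smooth

namespace PointTransf
variable {φ : PointTransf n} {H : VarSpace n → ℝ} {z : VarSpace n} {j : JetSpace n} {G F : ℂ}

lemma contDiffOn_Psi : ContDiffOn ℝ ∞ φ.Psi φ.map.source := φ.smooth.snd

lemma contDiffOn_X (b : Fin n) : ContDiffOn ℝ ∞ (φ.X b) φ.map.source :=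
  (Complex.ofRealCLM.comp ((spaceCoord b).comp
    (ContinuousLinearMap.fst ℝ (IndepVar n) ℂ))).contDiff.comp_contDiffOn φ.smooth

lemma contDiffOn_T : ContDiffOn ℝ ∞ φ.T φ.map.source :=
  Complex.ofRealCLM.contDiff.comp_contDiffOn φ.smooth.fst.fst

/-- The linear part of the action of the first prolongation of `φ` on the derivatives of `ψ`. -/
def jetLinear (φ : PointTransf n) (H : VarSpace n → ℝ) (z : VarSpace n) :
    (Fin n → ℂ) →L[ℝ] (Fin n → ℂ) :=
  ContinuousLinearMap.pi fun b => ∑ a, (dx a (φ.X b) z / H z) •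
    (conjLinear (dpsi φ.Psi z) (dpsiConj φ.Psi z)).comp (ContinuousLinearMap.proj a)

lemma jetLinear_apply (p : Fin n → ℂ) (b : Fin n) : φ.jetLinear H z p b =
    ∑ a, dx a (φ.X b) z / H z * conjLinear (dpsi φ.Psi z) (dpsiConj φ.Psi z) (p a) := by
  simp [jetLinear, sum_apply]

lemma prolongJet_eq : φ.prolongJet H j = (φ.map j.1,
    φ.jetLinear H j.1 j.2 + fun b => ∑ a, dx a (φ.X b) j.1 / H j.1 * dx a φ.Psi j.1) := by
  ext b
  · rfl
  · rfl
  · rfl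
  · simp only [prolongJet, Pi.add_apply, jetLinear_apply, ← Finset.sum_add_distrib, ← mul_add,
      conjLinear_apply, totalDx]
    exact Finset.sum_congr rfl fun a _ => by ring

lemma lowerTerms_eq (g : ℂ) : φ.lowerTerms H j g =
    (φ.lowerTerms H j 1 - φ.lowerTerms H j 0) * g + φ.lowerTerms H j 0 := by
  simp only [lowerTerms]
  ring

/-- A real-linear map `G ↦ G̃` depending smoothly on `Ψ_ψ` and `Ψ_{ψ*}`, which satisfies
condition (B) both where `Ψ_ψ Ψ_{ψ*} = 0` and where `G* = -G`:
`G̃ = (H / T_t) (|Ψ_ψ|² G - |Ψ_{ψ*}|² G*) / (|Ψ_ψ|² + |Ψ_{ψ*}|²)`. -/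
def gLinear (φ : PointTransf n) (H : VarSpace n → ℝ) (z : VarSpace n) : ℂ →L[ℝ] ℂ :=
  (H z / dt φ.T z / (dpsi φ.Psi z * conj (dpsi φ.Psi z)
      + dpsiConj φ.Psi z * conj (dpsiConj φ.Psi z))) •
    conjLinear (dpsi φ.Psi z * conj (dpsi φ.Psi z))
      (-(dpsiConj φ.Psi z * conj (dpsiConj φ.Psi z)))

/-- The linear part of the action on `(G, F)` given by `gLinear` and condition (C). -/
def arbLinear (φ : PointTransf n) (H : VarSpace n → ℝ) (j : JetSpace n) : ℂ × ℂ →L[ℝ] ℂ × ℂ :=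
  ((φ.gLinear H j.1).comp (ContinuousLinearMap.fst ℝ ℂ ℂ)).prod
    ((conjLinear (dpsi φ.Psi j.1 / dt φ.T j.1) (-(dpsiConj φ.Psi j.1 / dt φ.T j.1))).comp
        (ContinuousLinearMap.snd ℝ ℂ ℂ)
      + (φ.lowerTerms H j 1 - φ.lowerTerms H j 0) •
        (φ.gLinear H j.1).comp (ContinuousLinearMap.fst ℝ ℂ ℂ))

namespace ConformalEqs

lemma contDiffOn (h : φ.ConformalEqs H) : ContDiffOn ℝ ∞ (fun z => (H z : ℂ)) φ.map.source :=
  Complex.ofRealCLM.contDiff.comp_contDiffOn h.1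

lemma contDiffOn_dx_X_div (h : φ.ConformalEqs H) (a b : Fin n) :
    ContDiffOn ℝ ∞ (fun z => dx a (φ.X b) z / H z) φ.map.source :=
  contDiffOn_div (contDiffOn_dx φ.map.open_source (contDiffOn_X b) a) h.contDiffOn
    fun _ => h.ne_zero

lemma contDiffOn_lowerTerms (h : φ.ConformalEqs H) (g : ℂ) :
    ContDiffOn ℝ ∞ (fun j => φ.lowerTerms H j g) (Prod.fst ⁻¹' φ.map.source) := by
  have hs := φ.map.open_source
  have hD := contDiffOn_totalDx hs (contDiffOn_Psi (φ := φ))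
  have hHa (a : Fin n) := contDiffOn_comp_fst
    (contDiffOn_div (contDiffOn_dx hs h.contDiffOn a) h.contDiffOn fun _ => h.ne_zero)
  have hT := contDiffOn_comp_fst (contDiffOn_div (contDiffOn_const (c := Complex.I))
    (contDiffOn_dt hs contDiffOn_T) fun _ => h.dt_ne_zero)
  have hg := contDiffOn_comp_fst
    (contDiffOn_div (contDiffOn_const (c := g)) h.contDiffOn fun _ => h.ne_zero)
  have hspace := (contDiffOn_hatLaplacian hs contDiffOn_Psi).add
    ((contDiffOn_const (c := ((n : ℂ) - 2) / 2)).mul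
      (ContDiffOn.sum (s := Finset.univ) fun a _ => (hHa a).mul (hD a)))
  have htime := (contDiffOn_comp_fst (contDiffOn_dt hs contDiffOn_Psi)).sub
    (ContDiffOn.sum (s := Finset.univ) fun b _ => ContDiffOn.sum (s := Finset.univ) fun a _ =>
      ((contDiffOn_comp_fst (contDiffOn_dt hs (contDiffOn_X b))).mul
        (contDiffOn_comp_fst (h.contDiffOn_dx_X_div a b))).mul (hD a))
  exact (hspace.neg.mul hg).sub (hT.mul htime)

lemma jetLinear_injective (h : φ.ConformalEqs H) (hz : z ∈ φ.map.source) :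
    Function.Injective (φ.jetLinear H z) := by
  rw [injective_iff_map_eq_zero]
  intro p hp
  ext c
  refine (map_eq_zero_iff _ (h.conjLinear_injective hz)).1 ?_
  set w := fun a => conjLinear (dpsi φ.Psi z) (dpsiConj φ.Psi z) (p a)
  have hH := h.ne_zero hz
  calc w c = ∑ a, (∑ b, dx c (φ.X b) z * dx a (φ.X b) z) * (w a / H z) := by
        simp [h.orth_transpose hz, mul_div_cancel₀ _ hH]
    _ = ∑ b, dx c (φ.X b) z * φ.jetLinear H z p b := by
        simp only [jetLinear_apply, Finset.sum_mul, Finset.mul_sum]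
        rw [Finset.sum_comm]
        exact Finset.sum_congr rfl fun b _ => Finset.sum_congr rfl fun a _ => by ring
    _ = 0 := by simp [hp]

lemma exists_prolongJet (h : φ.ConformalEqs H) :
    ∃ J : OpenPartialHomeomorph (JetSpace n) (JetSpace n),
      J.source = Prod.fst ⁻¹' φ.map.source ∧ J.target = Prod.fst ⁻¹' φ.map.target ∧
      (∀ j, J j = φ.prolongJet H j) ∧
      ContDiffOn ℝ ∞ J J.source ∧ ContDiffOn ℝ ∞ J.symm J.target := by
  have hs := φ.map.open_source
  have hconj := contDiffOn_conjLinear (contDiffOn_dpsi hs (contDiffOn_Psi (φ := φ)))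
    (contDiffOn_dpsiConj hs contDiffOn_Psi)
  have hlinear (p : Fin n → ℂ) : ContDiffOn ℝ ∞ (fun z => φ.jetLinear H z p) φ.map.source := by
    refine contDiffOn_pi.2 fun b => ?_
    simp only [jetLinear_apply]
    exact ContDiffOn.sum fun a _ =>
      (h.contDiffOn_dx_X_div a b).mul (hconj.clm_apply contDiffOn_const)
  have hconst : ContDiffOn ℝ ∞
      (fun z b => ∑ a, dx a (φ.X b) z / H z * dx a φ.Psi z) φ.map.source :=
    contDiffOn_pi.2 fun b => ContDiffOn.sum fun a _ =>
      (h.contDiffOn_dx_X_div a b).mul (contDiffOn_dx hs contDiffOn_Psi a)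
  obtain ⟨J, hsource, htarget, hJ, hsmooth, hsymm⟩ := exists_affineSkewProduct φ.smooth
    φ.smooth_symm isOpen_univ hlinear hconst (fun z hz => h.jetLinear_injective hz)
    (fun _ _ _ => Iff.rfl)
  rw [prod_univ] at hsource htarget
  exact ⟨J, hsource, htarget, fun j => (hJ j).trans prolongJet_eq.symm, hsmooth, hsymm⟩

lemma normSq_add_normSq_ne_zero (h : φ.ConformalEqs H) (hz : z ∈ φ.map.source) :
    dpsi φ.Psi z * conj (dpsi φ.Psi z) + dpsiConj φ.Psi z * conj (dpsiConj φ.Psi z) ≠ 0 := by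
  rw [Complex.mul_conj', Complex.mul_conj']
  norm_cast
  rcases h.dpsi_ne_zero_or hz with hne | hne <;>
  · have := norm_pos_iff.2 hne
    positivity

lemma gLinear_injective (h : φ.ConformalEqs H) (hz : z ∈ φ.map.source) :
    Function.Injective (φ.gLinear H z) := by
  refine (smul_right_injective ℂ (div_ne_zero (div_ne_zero (h.ne_zero hz) (h.dt_ne_zero hz))
    (h.normSq_add_normSq_ne_zero hz))).comp (conjLinear_injective_iff.2 ?_)
  simpa [← sq] using h.norm_dpsi_ne hz

lemma contDiffOn_gLinear (h : φ.ConformalEqs H) : ContDiffOn ℝ ∞ (φ.gLinear H) φ.map.source := by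
  have hs := φ.map.open_source
  have hA := contDiffOn_dpsi hs (contDiffOn_Psi (φ := φ))
  have hB := contDiffOn_dpsiConj hs (contDiffOn_Psi (φ := φ))
  have hAA := hA.mul (contDiffOn_conj hA)
  have hBB := hB.mul (contDiffOn_conj hB)
  exact (contDiffOn_div (contDiffOn_div h.contDiffOn (contDiffOn_dt hs contDiffOn_T)
    fun _ => h.dt_ne_zero) (hAA.add hBB) fun _ => h.normSq_add_normSq_ne_zero).smul
    (contDiffOn_conjLinear hAA hBB.neg)

lemma arbLinear_injective (h : φ.ConformalEqs H) (hj : j.1 ∈ φ.map.source) :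
    Function.Injective (φ.arbLinear H j) := by
  rw [injective_iff_map_eq_zero]
  rintro ⟨g, k⟩ hgk
  obtain ⟨hg, hk⟩ := Prod.mk.inj hgk
  have hg0 : g = 0 := (map_eq_zero_iff _ (h.gLinear_injective hj)).1 hg
  have hinj : Function.Injective
      (conjLinear (dpsi φ.Psi j.1 / dt φ.T j.1) (-(dpsiConj φ.Psi j.1 / dt φ.T j.1))) := by
    rw [conjLinear_injective_iff, norm_neg, norm_div, norm_div]
    exact fun heq => h.norm_dpsi_ne hj
      ((div_left_inj' (norm_ne_zero_iff.2 (h.dt_ne_zero hj))).1 heq)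
  have hk0 : k = 0 := (map_eq_zero_iff _ hinj).1 (by simpa [hg0] using hk)
  rw [hg0, hk0, Prod.mk_zero_zero]

lemma contDiffOn_arbLinear_apply (h : φ.ConformalEqs H) (g : ℂ × ℂ) :
    ContDiffOn ℝ ∞ (fun j => φ.arbLinear H j g) (Prod.fst ⁻¹' φ.map.source) := by
  have hs := φ.map.open_source
  have hdiv {a : VarSpace n → ℂ} (ha : ContDiffOn ℝ ∞ a φ.map.source) :=
    contDiffOn_div ha (contDiffOn_dt hs contDiffOn_T) fun _ => h.dt_ne_zero
  have hconj := contDiffOn_conjLinear (hdiv (contDiffOn_dpsi hs contDiffOn_Psi))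
    (hdiv (contDiffOn_dpsiConj hs contDiffOn_Psi)).neg
  have hG := contDiffOn_comp_fst (h.contDiffOn_gLinear.clm_apply (contDiffOn_const (c := g.1)))
  exact hG.prodMk ((contDiffOn_comp_fst (hconj.clm_apply contDiffOn_const)).add
    (((h.contDiffOn_lowerTerms 1).sub (h.contDiffOn_lowerTerms 0)).mul hG))

lemma arbRel_arbLinear (h : φ.ConformalEqs H) (hj : j.1 ∈ φ.map.source)
    (hG : dpsi φ.Psi j.1 * dpsiConj φ.Psi j.1 = 0 ∨ conj G = -G) :
    φ.ArbRel H j G F (φ.arbLinear H j (G, F) + (0, φ.lowerTerms H j 0)).1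
      (φ.arbLinear H j (G, F) + (0, φ.lowerTerms H j 0)).2 := by
  have hN := h.normSq_add_normSq_ne_zero hj
  have hval : φ.gLinear H j.1 G = H j.1 / dt φ.T j.1 *
      ((dpsi φ.Psi j.1 * conj (dpsi φ.Psi j.1) * G
          - dpsiConj φ.Psi j.1 * conj (dpsiConj φ.Psi j.1) * conj G) /
        (dpsi φ.Psi j.1 * conj (dpsi φ.Psi j.1)
          + dpsiConj φ.Psi j.1 * conj (dpsiConj φ.Psi j.1))) := by
    simp only [gLinear, smul_apply, conjLinear_apply, smul_eq_mul]
    ring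
  have hfst : (φ.arbLinear H j (G, F) + (0, φ.lowerTerms H j 0)).1 = φ.gLinear H j.1 G :=
    add_zero _
  refine ⟨fun hA => ?_, fun hB => ?_, ?_⟩
  · rw [hfst, hval]
    congr 1
    rw [div_eq_iff hN]
    rcases hG with hAB | hG
    · simp [(mul_eq_zero.1 hAB).resolve_left hA, mul_comm]
    · rw [hG]
      ring
  · rw [hfst, hval]
    congr 1
    rw [div_eq_iff hN]
    rcases hG with hAB | hG
    · simp [(mul_eq_zero.1 hAB).resolve_right hB, mul_comm]
    · rw [hG]
      ring
  · rw [hfst, lowerTerms_eq (φ.gLinear H j.1 G)]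
    simp only [arbLinear, Prod.snd_add, ContinuousLinearMap.prod_apply, add_apply, smul_apply,
      ContinuousLinearMap.comp_apply, conjLinear_apply, ContinuousLinearMap.coe_fst',
      ContinuousLinearMap.coe_snd', smul_eq_mul]
    ring

lemma exists_totalTransf (h : φ.ConformalEqs H) :
    ∃ Φ : TotalTransf n, Φ.base = φ ∧ ∀ e ∈ Φ.map.source,
      dpsi φ.Psi e.1.1 * dpsiConj φ.Psi e.1.1 = 0 ∨ conj e.2.1 = -e.2.1 →
        φ.ArbRel H e.1 e.2.1 e.2.2 (Φ.map e).2.1 (Φ.map e).2.2 := by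
  obtain ⟨J, hJsource, hJtarget, hJ, hJsmooth, hJsymm⟩ := h.exists_prolongJet
  have hne : ∀ j ∈ J.source, ∀ g : ℂ × ℂ,
      (φ.arbLinear H j g + (0, φ.lowerTerms H j 0)).1 ≠ 0 ↔ g.1 ≠ 0 := fun j hj g => by
    rw [Prod.fst_add, add_zero]
    exact map_ne_zero_iff _ (h.gLinear_injective (hJsource.subset hj))
  obtain ⟨Φ, hsource, htarget, hΦ, hsmooth, hsymm⟩ := exists_affineSkewProduct hJsmooth hJsymm
    (isOpen_ne.preimage continuous_fst : IsOpen {g : ℂ × ℂ | g.1 ≠ 0})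
    (fun g => hJsource ▸ h.contDiffOn_arbLinear_apply g)
    (hJsource ▸ contDiffOn_const.prodMk (h.contDiffOn_lowerTerms 0))
    (fun j hj => h.arbLinear_injective (hJsource.subset hj)) hne
  refine ⟨⟨φ, Φ, hsmooth, hsymm, ?_, ?_, fun e _ => ?_, fun e _ e' _ hee => ?_,
    fun f q f' q' hm G F _ => ?_⟩, rfl, fun e he hG => ?_⟩
  · rw [hsource, hJsource]
    rfl
  · rw [htarget, hJtarget]
    rfl
  · rw [hΦ, hJ]
    rfl
  · rw [hΦ, hΦ, hee]
  · rw [hΦ, hJ, h.jet_eq hm]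
  · have hej := hJsource.subset (hsource.subset he).1
    simpa only [hΦ] using h.arbRel_arbLinear hej hG

end ConformalEqs
end PointTransf

/-! ### Action of transformations on equations -/

lemma exists_mem_classN_image {θ : Eqn n} (hθ : θ ∈ classN n)
    {J : OpenPartialHomeomorph (JetSpace n) (JetSpace n)} (hJ : ContDiffOn ℝ ∞ J.symm J.target)
    (hsub : θ.dom ⊆ J.source) : ∃ θ' ∈ classN n, θ'.dom = J '' θ.dom ∧
      ∀ j ∈ θ.dom, θ'.G (J j) = θ.G j ∧ θ'.F (J j) = θ.F j := by
  obtain ⟨hopen, hne, hG, hF, hG0⟩ := hθ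
  have hleft : ∀ j ∈ θ.dom, J.symm (J j) = j := fun j hj => J.left_inv (hsub hj)
  have hmaps : MapsTo J.symm (J '' θ.dom) θ.dom := by
    rintro _ ⟨j, hj, rfl⟩
    rwa [hleft j hj]
  have hsymm : ContDiffOn ℝ ∞ J.symm (J '' θ.dom) :=
    hJ.mono (image_subset_iff.2 fun j hj => J.map_source (hsub hj))
  exact ⟨⟨J '' θ.dom, θ.G ∘ J.symm, θ.F ∘ J.symm⟩,
    ⟨J.isOpen_image_of_subset_source hopen hsub, hne.image _, hG.comp hsymm hmaps,
      hF.comp hsymm hmaps, fun j' hj' => hG0 _ (hmaps hj')⟩, rfl,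
    fun j hj => ⟨congrArg θ.G (hleft j hj), congrArg θ.F (hleft j hj)⟩⟩

namespace PointTransf
variable {φ : PointTransf n} {θ θ' : Eqn n} {H : VarSpace n → ℝ}

lemma continuous_lowerTerms (φ : PointTransf n) (H : VarSpace n → ℝ) (j : JetSpace n) :
    Continuous (φ.lowerTerms H j) := by
  unfold lowerTerms
  fun_prop

lemma isClosed_arbRel (φ : PointTransf n) (H : VarSpace n → ℝ) (j : JetSpace n) (F : ℂ) :
    IsClosed {x : ℂ × ℂ × ℂ | φ.ArbRel H j x.1 F x.2.1 x.2.2} := by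
  have himp {p : Prop} {f g : ℂ × ℂ × ℂ → ℂ} (hf : Continuous f) (hg : Continuous g) :
      IsClosed {x | p → f x = g x} := by
    by_cases hp : p
    · simpa [hp] using isClosed_eq hf hg
    · simp [hp]
  have hlower := φ.continuous_lowerTerms H j
  exact (himp (by fun_prop) (by fun_prop)).inter
    ((himp (by fun_prop) (by fun_prop)).inter (isClosed_eq (by fun_prop) (by fun_prop)))

namespace ConformalEqs

lemma image_prolongJet_dom_of_mapsEqn [NeZero n] (h : φ.ConformalEqs H) (hm : φ.MapsEqn θ θ') :
    φ.prolongJet H '' θ.dom = θ'.dom := by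
  obtain ⟨J, hsource, htarget, hJ, -, -⟩ := h.exists_prolongJet
  refine hm.image_prolongJet_dom h fun j' hj' => ?_
  have ht : j' ∈ J.target := htarget.superset hj'
  exact ⟨J.symm j', hsource.subset (J.map_target ht), (hJ _).symm.trans (J.right_inv ht)⟩

end ConformalEqs

namespace MapsEqn

lemma mem_classN0_iff [NeZero n] (hm : φ.MapsEqn θ θ') (h : φ.ConformalEqs H)
    (hθ : θ ∈ classN n) (hθ' : θ' ∈ classN n) : θ' ∈ classN0 n ↔ θ ∈ classN0 n := by
  have hconj (j : JetSpace n) (hj : j ∈ θ.dom) :=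
    (hm.mem_dom_and_arbRel h hj).2.conj_eq_neg_iff h (hm.1 ⟨j, hj, rfl⟩)
  refine (and_iff_right hθ').trans (Iff.trans ?_ (and_iff_right hθ).symm)
  rw [← h.image_prolongJet_dom_of_mapsEqn hm, forall_mem_image]
  exact forall₂_congr fun j hj => not_congr (hconj j hj)

lemma mem_classN0bar_iff [NeZero n] (hm : φ.MapsEqn θ θ') (h : φ.ConformalEqs H)
    (hθ : θ ∈ classN n) (hθ' : θ' ∈ classN n) : θ' ∈ classN0bar n ↔ θ ∈ classN0bar n := by
  have hconj (j : JetSpace n) (hj : j ∈ θ.dom) :=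
    (hm.mem_dom_and_arbRel h hj).2.conj_eq_neg_iff h (hm.1 ⟨j, hj, rfl⟩)
  refine (and_iff_right hθ').trans (Iff.trans ?_ (and_iff_right hθ).symm)
  rw [← h.image_prolongJet_dom_of_mapsEqn hm, forall_mem_image]
  exact forall₂_congr hconj

lemma isUnmixed [NeZero n] (hm : φ.MapsEqn θ θ') (h : φ.ConformalEqs H)
    (hθ : θ ∈ classN0 n) (hsource : φ.map.source = θ.base) : φ.IsUnmixed := by
  intro z hz
  obtain ⟨j, hj, rfl⟩ := hsource.subset hz
  exact (hm.mem_dom_and_arbRel h hj).2.dpsi_mul_dpsiConj_eq_zero h hz (hθ.2 j hj)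

end MapsEqn
end PointTransf

namespace TotalTransf
variable {Φ : TotalTransf n} {H : VarSpace n → ℝ} {e : TotalSpace n} {θ θ' : Eqn n}

lemma formAt_iff : (Φ.GFormAt H e ∧ Φ.FFormAt H e) ↔
    Φ.base.ArbRel H e.1 e.2.1 e.2.2 (Φ.map e).2.1 (Φ.map e).2.2 := by
  rw [GFormAt, FFormAt, PointTransf.ArbRel, and_assoc, PointTransf.lowerTerms]
  refine and_congr_right fun _ => and_congr_right fun _ => ?_
  constructor <;> intro hF <;> rw [hF] <;> ring

lemma mem_source : e ∈ Φ.map.source ↔ e.1.1 ∈ Φ.base.map.source ∧ e.2.1 ≠ 0 := by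
  rw [Φ.source_eq]
  rfl

lemma map_fst [NeZero n] (h : Φ.base.ConformalEqs H) (he : e ∈ Φ.map.source) :
    (Φ.map e).1 = Φ.base.prolongJet H e.1 := by
  obtain ⟨hsource, hG⟩ := mem_source.1 he
  obtain ⟨f, f', hm, hjet, -, -⟩ := h.exists_mapsGerm hsource 0 0
  simpa only [hjet, h.jet_eq hm] using Φ.prolong _ _ _ _ hm e.2.1 e.2.2 hG

lemma map_ne_zero (he : e ∈ Φ.map.source) : (Φ.map e).2.1 ≠ 0 :=
  (Φ.target_eq.subset (Φ.map.map_source he)).2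

/-- The components of `Φ` satisfy conditions (B) and (C) at the points of the graph of the arbitrary
elements of `θ`. -/
def HasFormsOn (Φ : TotalTransf n) (H : VarSpace n → ℝ) (θ : Eqn n) : Prop :=
  ∀ e ∈ θ.graph, Φ.GFormAt H e ∧ Φ.FFormAt H e

lemma HasFormsOn.arbRel (hf : Φ.HasFormsOn H θ) {j : JetSpace n} (hj : j ∈ θ.dom) :
    Φ.base.ArbRel H j (θ.G j) (θ.F j) (Φ.map (j, (θ.G j, θ.F j))).2.1
      (Φ.map (j, (θ.G j, θ.F j))).2.2 :=
  formAt_iff.1 (hf _ ⟨j, hj, rfl⟩)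

lemma graph_subset_source (hθ : θ ∈ classN n) (hbase : θ.base ⊆ Φ.base.map.source) :
    θ.graph ⊆ Φ.map.source := by
  rintro _ ⟨j, hj, rfl⟩
  exact mem_source.2 ⟨hbase ⟨j, hj, rfl⟩, hθ.2.2.2.2 j hj⟩

lemma HasFormsOn.exists_mapsEqn (hf : Φ.HasFormsOn H θ) (h : Φ.base.ConformalEqs H)
    (hθ : θ ∈ classN n) (hbase : θ.base ⊆ Φ.base.map.source) :
    ∃ θ' ∈ classN n, Φ.base.MapsEqn θ θ' := by
  obtain ⟨J, hsource, -, hJ, -, hsymm⟩ := h.exists_prolongJet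
  have hgraph := graph_subset_source hθ hbase
  have hmaps : MapsTo (fun j => (j, (θ.G j, θ.F j))) θ.dom Φ.map.source := fun j hj =>
    hgraph ⟨j, hj, rfl⟩
  have hsmooth : ContDiffOn ℝ ∞ (fun j => Φ.map (j, (θ.G j, θ.F j))) θ.dom :=
    Φ.smooth.comp (contDiffOn_id.prodMk (hθ.2.2.1.prodMk hθ.2.2.2.1)) hmaps
  obtain ⟨θ', hθ', hdom, hval⟩ := exists_mem_classN_image
    (θ := ⟨θ.dom, fun j => (Φ.map (j, (θ.G j, θ.F j))).2.1,
      fun j => (Φ.map (j, (θ.G j, θ.F j))).2.2⟩)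
    ⟨hθ.1, hθ.2.1, hsmooth.snd.fst, hsmooth.snd.snd, fun j hj => map_ne_zero (hmaps hj)⟩ hsymm
    fun j hj => hsource.superset (hbase ⟨j, hj, rfl⟩)
  have hJ : (J : JetSpace n → JetSpace n) = Φ.base.prolongJet H := funext hJ
  rw [hJ] at hdom hval
  refine ⟨θ', hθ', h.mapsEqn hbase (hJ ▸ hsource ▸ J.injOn) hdom fun j hj => ?_⟩
  rw [(hval j hj).1, (hval j hj).2]
  exact hf.arbRel hj

lemma mapsArb_iff_hasFormsOn [NeZero n] (h : Φ.base.ConformalEqs H)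
    (hm : Φ.base.MapsEqn θ θ') (hθ : θ ∈ classN n) : Φ.MapsArb θ θ' ↔ Φ.HasFormsOn H θ := by
  have hfst (j : JetSpace n) (hj : j ∈ θ.dom) :
      (Φ.map (j, (θ.G j, θ.F j))).1 = Φ.base.prolongJet H j :=
    map_fst h (graph_subset_source hθ hm.1 ⟨j, hj, rfl⟩)
  refine ⟨fun ha => ?_, fun hf => ?_⟩
  · rintro _ ⟨j, hj, rfl⟩
    obtain ⟨j', hj', heq⟩ : Φ.map (j, (θ.G j, θ.F j)) ∈ θ'.graph :=
      ha.subset ⟨_, ⟨j, hj, rfl⟩, rfl⟩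
    obtain rfl : j' = Φ.base.prolongJet H j := (congrArg Prod.fst heq).trans (hfst j hj)
    rw [formAt_iff, ← heq]
    exact (hm.mem_dom_and_arbRel h hj).2
  · rw [MapsArb, Eqn.graph, Eqn.graph, ← h.image_prolongJet_dom_of_mapsEqn hm, image_image,
      image_image]
    refine image_congr fun j hj => ?_
    obtain ⟨hG, hF⟩ := (hf.arbRel hj).unique (hm.mem_dom_and_arbRel h hj).2 h (hm.1 ⟨j, hj, rfl⟩)
    exact Prod.ext (hfst j hj) (Prod.ext hG hF)

lemma arbRel_of_forall_conj_ne {j : JetSpace n} {F : ℂ}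
    (hrel : ∀ G, conj G ≠ -G →
      Φ.base.ArbRel H j G F (Φ.map (j, (G, F))).2.1 (Φ.map (j, (G, F))).2.2)
    (hj : j.1 ∈ Φ.base.map.source) {G : ℂ} (hG : G ≠ 0) :
    Φ.base.ArbRel H j G F (Φ.map (j, (G, F))).2.1 (Φ.map (j, (G, F))).2.2 := by
  by_cases hconj : conj G = -G
  swap
  · exact hrel G hconj
  have hG' : Tendsto (fun s : ℝ => (G + s : ℂ)) (𝓝[≠] 0) (𝓝 G) := by
    have hcont : Continuous fun s : ℝ => (G + s : ℂ) := by fun_prop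
    exact (hcont.tendsto' 0 G (by simp)).mono_left nhdsWithin_le_nhds
  have hmap : ContinuousAt Φ.map (j, (G, F)) := Φ.map.continuousAt (mem_source.2 ⟨hj, hG⟩)
  have hlim : Tendsto (fun s : ℝ => ((G + s : ℂ), (Φ.map (j, ((G + s : ℂ), F))).2))
      (𝓝[≠] 0) (𝓝 (G, (Φ.map (j, (G, F))).2)) :=
    hG'.prodMk_nhds (hmap.snd.tendsto.comp
      (tendsto_const_nhds.prodMk_nhds (hG'.prodMk_nhds tendsto_const_nhds)))
  refine (Φ.base.isClosed_arbRel H j F).mem_of_tendsto hlim ?_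
  filter_upwards [self_mem_nhdsWithin] with s hs
  refine hrel _ fun hconj' => hs ?_
  rw [map_add, hconj, Complex.conj_ofReal] at hconj'
  have hs0 : (s : ℂ) = 0 := by linear_combination hconj' / 2
  exact_mod_cast hs0

end TotalTransf

/-! ### Equivalence groups and normalization -/

/-- The equation with constant `G` and `F` over the set `s`. -/
def constEqn (s : Set (VarSpace n)) (G F : ℂ) : Eqn n := ⟨Prod.fst ⁻¹' s, fun _ => G, fun _ => F⟩

section ConstEqn
variable {s : Set (VarSpace n)} {G F : ℂ}

lemma base_constEqn (s : Set (VarSpace n)) (G F : ℂ) : (constEqn s G F).base = s :=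
  image_preimage_eq s Prod.fst_surjective

lemma constEqn_mem_classN (hs : IsOpen s) (hne : s.Nonempty) (hG : G ≠ 0) :
    constEqn s G F ∈ classN n :=
  ⟨hs.preimage continuous_fst, hne.preimage Prod.fst_surjective, contDiffOn_const, contDiffOn_const,
    fun _ _ => hG⟩

lemma constEqn_mem_classN0 (hs : IsOpen s) (hne : s.Nonempty) (hG : conj G ≠ -G) :
    constEqn s G F ∈ classN0 n :=
  ⟨constEqn_mem_classN hs hne (by rintro rfl; simp at hG), fun _ _ => hG⟩

lemma constEqn_mem_classN0bar (hs : IsOpen s) (hne : s.Nonempty) (hG0 : G ≠ 0)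
    (hG : conj G = -G) : constEqn s G F ∈ classN0bar n :=
  ⟨constEqn_mem_classN hs hne hG0, fun _ _ => hG⟩

end ConstEqn

lemma classN0_subset : classN0 n ⊆ classN n := fun _ hθ => hθ.1

lemma classN0bar_subset : classN0bar n ⊆ classN n := fun _ hθ => hθ.1

lemma disjoint_classN0_classN0bar : Disjoint (classN0 n) (classN0bar n) := by
  refine disjoint_left.2 fun θ hθ hθ' => ?_
  obtain ⟨j, hj⟩ := hθ.1.2.1
  exact hθ.2 j hj (hθ'.2 j hj)

/-- The class `C` contains each equation of the class `𝒩` to which a transformation satisfying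
condition (A) maps an equation of `C`. -/
def IsConformallyInvariant (C : Set (Eqn n)) : Prop :=
  ∀ φ H θ θ', PointTransf.ConformalEqs φ H → φ.MapsEqn θ θ' → θ ∈ C → θ' ∈ classN n → θ' ∈ C

lemma isConformallyInvariant_classN : IsConformallyInvariant (classN n) :=
  fun _ _ _ _ _ _ _ hθ' => hθ'

lemma isConformallyInvariant_classN0 [NeZero n] : IsConformallyInvariant (classN0 n) :=
  fun _ _ _ _ h hm hθ hθ' => (hm.mem_classN0_iff h hθ.1 hθ').2 hθ

lemma isConformallyInvariant_classN0bar [NeZero n] : IsConformallyInvariant (classN0bar n) :=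
  fun _ _ _ _ h hm hθ hθ' => (hm.mem_classN0bar_iff h hθ.1 hθ').2 hθ

lemma PointTransf.ConformalEqs.exists_forms {φ : PointTransf n} {H : VarSpace n → ℝ}
    (h : φ.ConformalEqs H) (hu : φ.IsUnmixed) : ∃ Φ : TotalTransf n, Φ.base = φ ∧
      ∀ e ∈ Φ.map.source, Φ.GFormAt H e ∧ Φ.FFormAt H e := by
  obtain ⟨Φ, rfl, hΦ⟩ := h.exists_totalTransf
  exact ⟨Φ, rfl, fun e he => TotalTransf.formAt_iff.2
    (hΦ e he (Or.inl (hu _ (TotalTransf.mem_source.1 he).1)))⟩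

lemma PointTransf.ConformalEqs.exists_forms_of_conj_eq_neg {φ : PointTransf n}
    {H : VarSpace n → ℝ} (h : φ.ConformalEqs H) : ∃ Φ : TotalTransf n, Φ.base = φ ∧
      ∀ e ∈ Φ.map.source, conj e.2.1 = -e.2.1 → Φ.GFormAt H e ∧ Φ.FFormAt H e := by
  obtain ⟨Φ, rfl, hΦ⟩ := h.exists_totalTransf
  exact ⟨Φ, rfl, fun e he hG => TotalTransf.formAt_iff.2 (hΦ e he (Or.inr hG))⟩

section EquivGroup
variable {C : Set (Eqn n)} {Φ : TotalTransf n} {H : VarSpace n → ℝ} {θ : Eqn n} {G F : ℂ}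

lemma TotalTransf.hasFormsOn_of_mem_classN
    (hf : ∀ e ∈ Φ.map.source, Φ.GFormAt H e ∧ Φ.FFormAt H e) (hθ : θ ∈ classN n)
    (hbase : θ.base ⊆ Φ.base.map.source) : Φ.HasFormsOn H θ :=
  fun e he => hf e (graph_subset_source hθ hbase he)

lemma TotalTransf.hasFormsOn_of_mem_classN0bar
    (hf : ∀ e ∈ Φ.map.source, conj e.2.1 = -e.2.1 → Φ.GFormAt H e ∧ Φ.FFormAt H e)
    (hθ : θ ∈ classN0bar n) (hbase : θ.base ⊆ Φ.base.map.source) : Φ.HasFormsOn H θ := by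
  rintro _ ⟨j, hj, rfl⟩
  exact hf _ (graph_subset_source hθ.1 hbase ⟨j, hj, rfl⟩) (hθ.2 j hj)

lemma IsConformallyInvariant.mem_equivGroup [NeZero n] (hinv : IsConformallyInvariant C)
    (hC : C ⊆ classN n) (h : Φ.base.ConformalEqs H)
    (hf : ∀ θ ∈ C, θ.base ⊆ Φ.base.map.source → Φ.HasFormsOn H θ) : Φ ∈ equivGroup C := by
  intro θ hθ hbase
  obtain ⟨θ', hθ', hm⟩ := (hf θ hθ hbase).exists_mapsEqn h (hC hθ) hbase
  exact ⟨θ', hinv _ _ _ _ h hm hθ hθ',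
    (TotalTransf.mapsArb_iff_hasFormsOn h hm (hC hθ)).2 (hf θ hθ hbase), hm⟩

lemma exists_conformalEqs_of_mem_equivGroup (hn : 2 ≤ n) (hC : C ⊆ classN n)
    (hΦ : Φ ∈ equivGroup C)
    (hmem : Φ.base.map.source.Nonempty → constEqn Φ.base.map.source G F ∈ C) :
    ∃ H, Φ.base.ConformalEqs H := by
  rcases Φ.base.map.source.eq_empty_or_nonempty with hempty | hne
  · refine ⟨fun _ => 0, contDiffOn_const, ?_⟩
    simp only [hempty, mem_empty_iff_false, IsEmpty.forall_iff, implies_true]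
  · obtain ⟨θ', -, -, hm⟩ := hΦ _ (hmem hne) (base_constEqn _ _ _).le
    exact hm.exists_conformalEqs hn (hC (hmem hne)) (base_constEqn _ _ _).symm

lemma arbRel_of_mem_equivGroup [NeZero n] (hC : C ⊆ classN n) (h : Φ.base.ConformalEqs H)
    (hΦ : Φ ∈ equivGroup C) (hmem : constEqn Φ.base.map.source G F ∈ C) {j : JetSpace n}
    (hj : j.1 ∈ Φ.base.map.source) :
    Φ.base.ArbRel H j G F (Φ.map (j, (G, F))).2.1 (Φ.map (j, (G, F))).2.2 := by
  obtain ⟨θ', -, ha, hm⟩ := hΦ _ hmem (base_constEqn _ _ _).le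
  exact ((TotalTransf.mapsArb_iff_hasFormsOn h hm (hC hmem)).1 ha).arbRel hj

lemma mem_equivGroup_iff (hn : 2 ≤ n) (hC : C ⊆ classN n) (hC0 : classN0 n ⊆ C)
    (hinv : IsConformallyInvariant C) : Φ ∈ equivGroup C ↔
      ∃ H, Φ.base.ConformalEqs H ∧ Φ.base.IsUnmixed ∧
        ∀ e ∈ Φ.map.source, Φ.GFormAt H e ∧ Φ.FFormAt H e := by
  have : NeZero n := ⟨by omega⟩
  refine ⟨fun hΦ => ?_, fun ⟨H, h, _, hf⟩ => hinv.mem_equivGroup hC h fun θ hθ =>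
    TotalTransf.hasFormsOn_of_mem_classN hf (hC hθ)⟩
  have hmem {G F : ℂ} (hG : conj G ≠ -G) (hne : Φ.base.map.source.Nonempty) :
      constEqn Φ.base.map.source G F ∈ C :=
    hC0 (constEqn_mem_classN0 Φ.base.map.open_source hne hG)
  have hone : conj (1 : ℂ) ≠ -1 := by
    rw [map_one]
    norm_num
  obtain ⟨H, h⟩ := exists_conformalEqs_of_mem_equivGroup hn hC hΦ (hmem (F := 0) hone)
  have hrel {j : JetSpace n} (hj : j.1 ∈ Φ.base.map.source) (F G : ℂ) (hG : conj G ≠ -G) :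
      Φ.base.ArbRel H j G F (Φ.map (j, (G, F))).2.1 (Φ.map (j, (G, F))).2.2 :=
    arbRel_of_mem_equivGroup hC h hΦ (hmem hG ⟨_, hj⟩) hj
  refine ⟨H, h, fun z hz => ?_, fun e he => TotalTransf.formAt_iff.2 ?_⟩
  · have hz' : ((z, 0) : JetSpace n).1 ∈ Φ.base.map.source := hz
    exact (hrel hz' 0 1 hone).dpsi_mul_dpsiConj_eq_zero h hz' hone
  · obtain ⟨hj, hG⟩ := TotalTransf.mem_source.1 he
    exact TotalTransf.arbRel_of_forall_conj_ne (hrel hj e.2.2) hj hG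

lemma mem_equivGroup_classN0bar_iff (hn : 2 ≤ n) : Φ ∈ equivGroup (classN0bar n) ↔
    ∃ H, Φ.base.ConformalEqs H ∧
      ∀ e ∈ Φ.map.source, conj e.2.1 = -e.2.1 → Φ.GFormAt H e ∧ Φ.FFormAt H e := by
  have : NeZero n := ⟨by omega⟩
  refine ⟨fun hΦ => ?_, fun ⟨H, h, hf⟩ => isConformallyInvariant_classN0bar.mem_equivGroup
    classN0bar_subset h fun θ => TotalTransf.hasFormsOn_of_mem_classN0bar hf⟩
  have hmem {G F : ℂ} (hG0 : G ≠ 0) (hG : conj G = -G) (hne : Φ.base.map.source.Nonempty) :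
      constEqn Φ.base.map.source G F ∈ classN0bar n :=
    constEqn_mem_classN0bar Φ.base.map.open_source hne hG0 hG
  obtain ⟨H, h⟩ := exists_conformalEqs_of_mem_equivGroup hn classN0bar_subset hΦ
    (hmem (F := 0) Complex.I_ne_zero Complex.conj_I)
  refine ⟨H, h, fun e he hG => TotalTransf.formAt_iff.2 ?_⟩
  obtain ⟨hj, hG0⟩ := TotalTransf.mem_source.1 he
  exact arbRel_of_mem_equivGroup classN0bar_subset h hΦ (hmem hG0 hG ⟨_, hj⟩) hj

lemma mem_equivGroup_classN_iff (hn : 2 ≤ n) : Φ ∈ equivGroup (classN n) ↔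
    ∃ H, Φ.base.ConformalEqs H ∧ Φ.base.IsUnmixed ∧
      ∀ e ∈ Φ.map.source, Φ.GFormAt H e ∧ Φ.FFormAt H e :=
  mem_equivGroup_iff hn Subset.rfl classN0_subset isConformallyInvariant_classN

lemma equivGroup_classN0 (hn : 2 ≤ n) : equivGroup (classN0 n) = equivGroup (classN n) := by
  have : NeZero n := ⟨by omega⟩
  ext Φ
  rw [mem_equivGroup_classN_iff hn,
    mem_equivGroup_iff hn classN0_subset Subset.rfl isConformallyInvariant_classN0]

lemma exists_mem_equivGroup_classN (hn : 2 ≤ n) {φ : PointTransf n} (h : ∃ H, φ.ConformalEqs H)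
    (hu : φ.IsUnmixed) : ∃ Φ ∈ equivGroup (classN n), Φ.base = φ := by
  obtain ⟨H, h⟩ := h
  obtain ⟨Φ, rfl, hf⟩ := h.exists_forms hu
  exact ⟨Φ, (mem_equivGroup_classN_iff hn).2 ⟨H, h, hu, hf⟩, rfl⟩

lemma exists_mem_equivGroup_classN0bar (hn : 2 ≤ n) {φ : PointTransf n}
    (h : ∃ H, φ.ConformalEqs H) : ∃ Φ ∈ equivGroup (classN0bar n), Φ.base = φ := by
  obtain ⟨H, h⟩ := h
  obtain ⟨Φ, rfl, hf⟩ := h.exists_forms_of_conj_eq_neg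
  exact ⟨Φ, (mem_equivGroup_classN0bar_iff hn).2 ⟨H, h, hf⟩, rfl⟩

lemma IsConformallyInvariant.isNormalized (hinv : IsConformallyInvariant C) (hn : 2 ≤ n)
    (hC : C ⊆ classN n)
    (hforms : ∀ φ H θ θ', PointTransf.ConformalEqs φ H → φ.IsAdmissible θ θ' → θ ∈ C →
      ∃ Φ : TotalTransf n, Φ.base = φ ∧
        ∀ θ ∈ C, θ.base ⊆ Φ.base.map.source → Φ.HasFormsOn H θ) : IsNormalized C := by
  have : NeZero n := ⟨by omega⟩
  intro θ hθ θ' _ φ hadm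
  obtain ⟨H, h⟩ := hadm.2.exists_conformalEqs hn (hC hθ) hadm.1
  obtain ⟨Φ, rfl, hf⟩ := hforms φ H θ θ' h hadm hθ
  exact ⟨Φ, hinv.mem_equivGroup hC h hf, rfl,
    (TotalTransf.mapsArb_iff_hasFormsOn h hadm.2 (hC hθ)).2 (hf θ hθ hadm.2.1)⟩

lemma isNormalized_classN0 (hn : 2 ≤ n) : IsNormalized (classN0 n) := by
  have : NeZero n := ⟨by omega⟩
  refine isConformallyInvariant_classN0.isNormalized hn classN0_subset ?_
  rintro φ H θ θ' h ⟨hsource, hm⟩ hθ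
  obtain ⟨Φ, hΦ, hf⟩ := h.exists_forms (hm.isUnmixed h hθ hsource)
  exact ⟨Φ, hΦ, fun θ hθ => TotalTransf.hasFormsOn_of_mem_classN hf hθ.1⟩

lemma isNormalized_classN0bar (hn : 2 ≤ n) : IsNormalized (classN0bar n) := by
  have : NeZero n := ⟨by omega⟩
  refine isConformallyInvariant_classN0bar.isNormalized hn classN0bar_subset ?_
  intro φ H _ _ h _ _
  obtain ⟨Φ, hΦ, hf⟩ := h.exists_forms_of_conj_eq_neg
  exact ⟨Φ, hΦ, fun θ => TotalTransf.hasFormsOn_of_mem_classN0bar hf⟩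

end EquivGroup

lemma PointTransf.IsAdmissible.mem_classN0_iff {φ : PointTransf n} {θ θ' : Eqn n}
    (hadm : φ.IsAdmissible θ θ') (hn : 2 ≤ n) (hθ : θ ∈ classN n) (hθ' : θ' ∈ classN n) :
    θ' ∈ classN0 n ↔ θ ∈ classN0 n := by
  have : NeZero n := ⟨by omega⟩
  obtain ⟨H, h⟩ := hadm.2.exists_conformalEqs hn hθ hadm.1
  exact hadm.2.mem_classN0_iff h hθ hθ'

lemma not_isAdmissible_and_not_isAdmissible (hn : 2 ≤ n) {θ θ' : Eqn n} (hθ : θ ∈ classN0 n)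
    (hθ' : θ' ∈ classN0bar n) (φ : PointTransf n) :
    ¬ φ.IsAdmissible θ θ' ∧ ¬ φ.IsAdmissible θ' θ := by
  have hnot : θ' ∉ classN0 n := disjoint_right.1 disjoint_classN0_classN0bar hθ'
  exact ⟨fun hadm => hnot ((hadm.mem_classN0_iff hn hθ.1 hθ'.1).2 hθ),
    fun hadm => hnot ((hadm.mem_classN0_iff hn hθ'.1 hθ.1).1 hθ)⟩

/-! ### Transformations mixing `ψ` and `ψ*` -/

/-- The point transformation `(t, x, ψ) ↦ (t, x, e ψ)`. -/
def PointTransf.ofLinear (n : ℕ) (e : ℂ ≃L[ℝ] ℂ) : PointTransf n where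
  map := ((ContinuousLinearEquiv.refl ℝ (IndepVar n)).prodCongr e).toHomeomorph
    |>.toOpenPartialHomeomorph
  smooth := ((ContinuousLinearEquiv.refl ℝ (IndepVar n)).prodCongr e).contDiff.contDiffOn
  smooth_symm := ((ContinuousLinearEquiv.refl ℝ (IndepVar n)).prodCongr e).symm.contDiff.contDiffOn

namespace PointTransf
variable {e : ℂ ≃L[ℝ] ℂ}

lemma fderiv_ofLinear (z u : VarSpace n) : fderiv ℝ (ofLinear n e).map z u = (u.1, e u.2) :=
  congrArg (· u) ((ContinuousLinearEquiv.refl ℝ (IndepVar n)).prodCongr e).fderiv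

lemma conformalEqs_ofLinear [NeZero n] : (ofLinear n e).ConformalEqs fun _ => 1 := by
  refine conformalEqs_of_isConformal fun z _ => ⟨one_pos, fun w => ?_, fun a => ?_, ?_,
    fun b c => ?_⟩ <;> simp [indepDiff_apply, fderiv_ofLinear, spaceVec, timeVec, Pi.single_apply]

end PointTransf

lemma exists_not_isUnmixed (n : ℕ) [NeZero n] : ∃ φ : PointTransf n, φ.map.source = univ ∧
    φ.ConformalEqs (fun _ => 1) ∧ ¬ φ.IsUnmixed := by
  have hinj : Function.Injective (conjLinear 2 1) := conjLinear_injective_iff.2 (by norm_num)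
  let e : ℂ ≃L[ℝ] ℂ :=
    (LinearEquiv.ofInjectiveEndo (conjLinear 2 1).toLinearMap hinj).toContinuousLinearEquiv
  refine ⟨PointTransf.ofLinear n e, rfl, PointTransf.conformalEqs_ofLinear, fun hu => ?_⟩
  have hzero := hu 0 (mem_univ _)
  have hPsi (w : ℂ) : fderiv ℝ (PointTransf.ofLinear n e).Psi 0 (0, w) = 2 * w + conj w := by
    rw [PointTransf.fderiv_Psi (mem_univ _), PointTransf.fderiv_ofLinear, ← one_mul (conj w)]
    exact conjLinear_apply 2 1 w
  simp only [dpsi, dpsiConj, hPsi, map_one, Complex.conj_I] at hzero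
  have : (2 : ℂ) = 0 := by
    linear_combination hzero + (Complex.I ^ 2 - 1) / 4 * Complex.I_sq
  norm_num at this

lemma not_isNormalized_classN (hn : 2 ≤ n) : ¬ IsNormalized (classN n) := by
  intro hN
  have : NeZero n := ⟨by omega⟩
  obtain ⟨φ, hsource, h, hmixed⟩ := exists_not_isUnmixed n
  obtain ⟨Φ, hΦ, rfl⟩ := exists_mem_equivGroup_classN0bar hn ⟨_, h⟩
  have hθ : constEqn (univ : Set (VarSpace n)) Complex.I 0 ∈ classN0bar n :=
    constEqn_mem_classN0bar isOpen_univ univ_nonempty Complex.I_ne_zero Complex.conj_I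
  obtain ⟨θ', hθ', -, hm⟩ := hΦ _ hθ (by rw [hsource]; exact subset_univ _)
  obtain ⟨Φ', hΦ', hbase, -⟩ :=
    hN _ hθ.1 θ' hθ'.1 Φ.base ⟨hsource.trans (base_constEqn _ _ _).symm, hm⟩
  obtain ⟨-, -, hu, -⟩ := (mem_equivGroup_classN_iff hn).1 hΦ'
  exact hmixed (hbase ▸ hu)

/-! ### Partition -/

lemma exists_partition {θ : Eqn n} (hθ : θ ∈ classN n) :
    ∃ U₀ U₁ : Set (JetSpace n), IsOpen U₀ ∧ IsOpen U₁ ∧ Disjoint U₀ U₁ ∧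
      U₀ ⊆ θ.dom ∧ U₁ ⊆ θ.dom ∧ θ.dom ⊆ closure (U₀ ∪ U₁) ∧
      (U₀.Nonempty → θ.restrict U₀ ∈ classN0 n) ∧
      (U₁.Nonempty → θ.restrict U₁ ∈ classN0bar n) := by
  obtain ⟨hopen, -, hG, hF, hG0⟩ := hθ
  set U₀ := θ.dom ∩ θ.G ⁻¹' {g | conj g ≠ -g}
  set U₁ := θ.dom \ closure U₀
  have hU₀ : IsOpen U₀ := hG.continuousOn.isOpen_inter_preimage hopen
    (isOpen_ne_fun Complex.continuous_conj continuous_neg)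
  have hU₁ : IsOpen U₁ := hopen.sdiff isClosed_closure
  have hmem {U : Set (JetSpace n)} (hU : IsOpen U) (hne : U.Nonempty) (hsub : U ⊆ θ.dom) :
      θ.restrict U ∈ classN n :=
    ⟨hU, hne, hG.mono hsub, hF.mono hsub, fun j hj => hG0 j (hsub hj)⟩
  refine ⟨U₀, U₁, hU₀, hU₁, disjoint_sdiff_right.mono_left subset_closure, inter_subset_left,
    sdiff_subset, fun j hj => ?_, fun hne => ⟨hmem hU₀ hne inter_subset_left, fun j hj => hj.2⟩,
    fun hne => ⟨hmem hU₁ hne sdiff_subset, fun j hj => ?_⟩⟩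
  · by_cases hcl : j ∈ closure U₀
    · exact closure_mono subset_union_left hcl
    · exact subset_closure (Or.inr ⟨hj, hcl⟩)
  · by_contra hne
    exact hj.2 (subset_closure ⟨hj.1, hne⟩)

end GenSchr

end

open GenSchr in
theorem mainTheorem2 (n : ℕ) (hn : 2 ≤ n) :
    -- the class is not normalized
    ¬ IsNormalized (classN n) ∧
    -- its equivalence group
    (∀ Φ : TotalTransf n, Φ ∈ equivGroup (classN n) ↔
      ∃ H, Φ.base.ConformalEqs H ∧ Φ.base.IsUnmixed ∧
        ∀ e ∈ Φ.map.source, Φ.GFormAt H e ∧ Φ.FFormAt H e) ∧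
    (∀ φ : PointTransf n, (∃ H, φ.ConformalEqs H) → φ.IsUnmixed →
      ∃ Φ ∈ equivGroup (classN n), Φ.base = φ) ∧
    -- partition into two disjoint subclasses, up to a nowhere dense part of each domain
    classN0 n ⊆ classN n ∧ classN0bar n ⊆ classN n ∧ Disjoint (classN0 n) (classN0bar n) ∧
    (∀ θ ∈ classN n, ∃ U₀ U₁ : Set (JetSpace n), IsOpen U₀ ∧ IsOpen U₁ ∧ Disjoint U₀ U₁ ∧
      U₀ ⊆ θ.dom ∧ U₁ ⊆ θ.dom ∧ θ.dom ⊆ closure (U₀ ∪ U₁) ∧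
      (U₀.Nonempty → θ.restrict U₀ ∈ classN0 n) ∧
      (U₁.Nonempty → θ.restrict U₁ ∈ classN0bar n)) ∧
    -- the subclasses are normalized and not related by point transformations
    IsNormalized (classN0 n) ∧ IsNormalized (classN0bar n) ∧
    (∀ θ ∈ classN0 n, ∀ θ' ∈ classN0bar n, ∀ φ : PointTransf n,
      ¬ φ.IsAdmissible θ θ' ∧ ¬ φ.IsAdmissible θ' θ) ∧
    -- their equivalence groups
    equivGroup (classN0 n) = equivGroup (classN n) ∧
    (∀ Φ : TotalTransf n, Φ ∈ equivGroup (classN0bar n) ↔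
      ∃ H, Φ.base.ConformalEqs H ∧
        ∀ e ∈ Φ.map.source, conj e.2.1 = -e.2.1 → Φ.GFormAt H e ∧ Φ.FFormAt H e) ∧
    (∀ φ : PointTransf n, (∃ H, φ.ConformalEqs H) →
      ∃ Φ ∈ equivGroup (classN0bar n), Φ.base = φ) := by
  exact ⟨not_isNormalized_classN hn, fun _ => mem_equivGroup_classN_iff hn,
    fun _ => exists_mem_equivGroup_classN hn, classN0_subset, classN0bar_subset,
    disjoint_classN0_classN0bar, fun _ => exists_partition, isNormalized_classN0 hn,
    isNormalized_classN0bar hn, fun _ hθ _ hθ' => not_isAdmissible_and_not_isAdmissible hn hθ hθ',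
    equivGroup_classN0 hn, fun _ => mem_equivGroup_classN0bar_iff hn,
    fun _ => exists_mem_equivGroup_classN0bar hn⟩
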